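/- **Setting.** Let $X_{i,j}$ ($i,j\ge1$) be i.i.d. random vectors in $\mathbb R^d$, let $g(x;\theta)\in\mathbb R^r$ be an estimating function, measurable in $x$ for every $\theta\in\mathbb R^p$, and let $\theta_0\in\mathbb R^p$ satisfy $\mathrm E\{g(X;\theta_0)\}=0$. For each $n$ let $K=K_n\ge 1$ be the number of nodes ($K_n$ may be constant or vary with $n$), $N=K_nn$, let $\mathcal N_i$ be the set of neighbours of node $i$ in a given network on the nodes $1,\dots,K_n$, and let $\eta_n>0$. The $i$-th node holds $X_{i,1},\dots,X_{i,n}$. Put $$\ell_i(\lambda)=-2\sum_{j=1}^n\log\{1+\lambda^\top g(X_{i,j};\theta)\},\qquad \ell(\lambda)=\sum_{i=1}^{K}\ell_i(\lambda),$$ $$\ell_{lasso}(\lambda_1,\dots,\lambda_K)=\sum_{i=1}^{K}\ell_i(\lambda_i)+\sum_{i=1}^{K}\sum_{i'\in\mathcal N_i,\ i'>i}\eta_n\|\lambda_i-\lambda_{i'}\|_2 ,$$ each on the set where all arguments of the logarithms are positive. Let $\hat\lambda^*=\arg\min\ell$, $\hat\Lambda=\arg\min\ell_{lasso}$ and $\hat\Lambda^*=(\hat\lambda^*,\dots,\hat\lambda^*)$.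 **Theorem 2.1.** Assume that every network is connected and that $\mathrm E\{g(X;\theta_0)g(X;\theta_0)^\top\}$ is finite and positive definite. (1) Suppose $\eta_n/N^2\to\infty$. Let $\theta\in\mathbb R^p$ be fixed with $\mathrm E\|g(X;\theta)\|_2<\infty$. Then $\Pr(\hat\Lambda=\hat\Lambda^*)\to1$ as $n\to\infty$, in the following sense: with probability tending to $1$, the set of minimizers of $\ell_{lasso}$ is exactly $\{(\lambda,\dots,\lambda):\lambda\text{ minimizes }\ell\}$ (in particular one problem has a solution if and only if the other has), and, whenever $0$ is an interior point of the convex hull of the points $g(X_{i,j};\theta)$, $1\le i\le K$, $1\le j\le n$, both minimizers exist, are unique, and $\hat\Lambda=\hat\Lambda^*$. For $\theta=\theta_0$, with probability tending to $1$ both minimizers exist, are unique, and $\hat\Lambda=\hat\Lambda^*$. (2) Suppose instead that $\eta_n/(K\sqrt{n\log K})\to\infty$ (where the ratio is read as $+\infty$ if $K=1$), that $g$ is regular at $\theta_0$ in the sense that $$\mathrm E\|g(X;\theta)-g(X;\theta_0)\|_2^2\to0\quad\text{and}\quad \|\mathrm E\,g(X;\theta)\|_2=O(\|\theta-\theta_0\|_2)\qquad(\theta\to\theta_0),$$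 and that $\theta=\theta_n$ satisfies $\|\theta_n-\theta_0\|_2=O(N^{-1/2})$. Then, with probability tending to $1$ as $n\to\infty$, both minimizers (formed with $\theta=\theta_n$) exist, are unique, and $\hat\Lambda=\hat\Lambda^*$. -/

import Mathlib

open Filter Topology MeasureTheory ProbabilityTheory Asymptotics
open scoped RealInnerProductSpace

noncomputable section

namespace DecentralizedEL

/-! Finite-sample objects: `y i j` stands for the value `g (X i j) θ` of the estimating function
at the `j`-th observation of node `i`. -/

/-- The multipliers admissible at one node: all the arguments of the logarithm are positive. -/
def localDomain {n r : ℕ} (y : Fin n → EuclideanSpace ℝ (Fin r)) :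
    Set (EuclideanSpace ℝ (Fin r)) :=
  {lam | ∀ j, 0 < 1 + ⟪lam, y j⟫}

/-- The local objective `ℓ_i(lam) = -2 ∑ j, log (1 + lamᵀ y j)`. -/
def localObj {n r : ℕ} (y : Fin n → EuclideanSpace ℝ (Fin r))
    (lam : EuclideanSpace ℝ (Fin r)) : ℝ :=
  -2 * ∑ j, Real.log (1 + ⟪lam, y j⟫)

/-- The multipliers admissible at every node. -/
def globalDomain {K n r : ℕ} (y : Fin K → Fin n → EuclideanSpace ℝ (Fin r)) :
    Set (EuclideanSpace ℝ (Fin r)) :=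
  {lam | ∀ i, lam ∈ localDomain (y i)}

/-- The global objective `ℓ(lam) = ∑ i, ℓ_i(lam)`. -/
def globalObj {K n r : ℕ} (y : Fin K → Fin n → EuclideanSpace ℝ (Fin r))
    (lam : EuclideanSpace ℝ (Fin r)) : ℝ :=
  ∑ i, localObj (y i) lam

/-- The set of global Lagrange multipliers: all minimizers of `ℓ` over its domain. -/
def globalArgmin {K n r : ℕ} (y : Fin K → Fin n → EuclideanSpace ℝ (Fin r)) :
    Set (EuclideanSpace ℝ (Fin r)) :=
  {lam | lam ∈ globalDomain y ∧ IsMinOn (globalObj y) (globalDomain y) lam}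

/-- The admissible families `Lam = (lam_1, …, lam_K)` of local multipliers. -/
def lassoDomain {K n r : ℕ} (y : Fin K → Fin n → EuclideanSpace ℝ (Fin r)) :
    Set (Fin K → EuclideanSpace ℝ (Fin r)) :=
  {Lam | ∀ i, Lam i ∈ localDomain (y i)}

open Classical in
/-- The fused-lasso objective: the sum of the local objectives plus `η ‖lam_i - lam_i'‖` for each
edge `{i, i'}`, `i < i'`, of the network `G`. -/
def lassoObj {K n r : ℕ} (G : SimpleGraph (Fin K)) (η : ℝ)
    (y : Fin K → Fin n → EuclideanSpace ℝ (Fin r))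
    (Lam : Fin K → EuclideanSpace ℝ (Fin r)) : ℝ :=
  ∑ i, localObj (y i) (Lam i) +
    ∑ i, ∑ i' with G.Adj i i' ∧ i < i', η * ‖Lam i - Lam i'‖

/-- The set of all minimizers of the fused-lasso objective over its domain. -/
def lassoArgmin {K n r : ℕ} (G : SimpleGraph (Fin K)) (η : ℝ)
    (y : Fin K → Fin n → EuclideanSpace ℝ (Fin r)) :
    Set (Fin K → EuclideanSpace ℝ (Fin r)) :=
  {Lam | Lam ∈ lassoDomain y ∧ IsMinOn (lassoObj G η y) (lassoDomain y) Lam}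

/-- The stacked vector `(lam, …, lam)`. -/
def stack (K : ℕ) {r : ℕ} (lam : EuclideanSpace ℝ (Fin r)) :
    Fin K → EuclideanSpace ℝ (Fin r) :=
  fun _ => lam

/-- `0` lies inside the convex hull of the `N = K n` points `y i j`. -/
def ZeroInsideHull {K n r : ℕ} (y : Fin K → Fin n → EuclideanSpace ℝ (Fin r)) : Prop :=
  (0 : EuclideanSpace ℝ (Fin r)) ∈
    interior (convexHull ℝ (Set.range fun ij : Fin K × Fin n => y ij.1 ij.2))

/-- The two minimization problems have the same solutions, as sets: the minimizers of the
fused-lasso objective are exactly the stacked minimizers of the global objective. -/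
def SameSolutions {K n r : ℕ} (G : SimpleGraph (Fin K)) (η : ℝ)
    (y : Fin K → Fin n → EuclideanSpace ℝ (Fin r)) : Prop :=
  lassoArgmin G η y = stack K '' globalArgmin y

/-- Both minimizers exist and are unique, and the fused-lasso minimizer is the stacked global
Lagrange multiplier. -/
def MinimizersCoincide {K n r : ℕ} (G : SimpleGraph (Fin K)) (η : ℝ)
    (y : Fin K → Fin n → EuclideanSpace ℝ (Fin r)) : Prop :=
  ∃ lam, globalArgmin y = {lam} ∧ lassoArgmin G η y = {stack K lam}

/-- The values `g (X i j) θ`, `i < K`, `j < n`, at the sample point `ω`. -/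
def gValues {Ω : Type*} {d p r : ℕ} (X : ℕ → ℕ → Ω → EuclideanSpace ℝ (Fin d))
    (g : EuclideanSpace ℝ (Fin d) → EuclideanSpace ℝ (Fin p) → EuclideanSpace ℝ (Fin r))
    (K n : ℕ) (θ : EuclideanSpace ℝ (Fin p)) (ω : Ω) :
    Fin K → Fin n → EuclideanSpace ℝ (Fin r) :=
  fun i j => g (X i j ω) θ

/-- The second moment matrix `E {g(X; θ) g(X; θ)ᵀ}` when `X` has law `μ`. -/
def secondMomentMatrix {d p r : ℕ} (μ : Measure (EuclideanSpace ℝ (Fin d)))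
    (g : EuclideanSpace ℝ (Fin d) → EuclideanSpace ℝ (Fin p) → EuclideanSpace ℝ (Fin r))
    (θ : EuclideanSpace ℝ (Fin p)) : Matrix (Fin r) (Fin r) ℝ :=
  Matrix.of fun a b => ∫ x, g x θ a * g x θ b ∂μ

/-- The events `E n` hold with probability tending to one. It is stated through the (outer) measure
of the complements, so that it is the strong form even if some `E n` is not measurable. -/
def WithProbTendingToOne {Ω : Type*} [MeasurableSpace Ω] (P : Measure Ω)
    (E : ℕ → Ω → Prop) : Prop :=
  Tendsto (fun n => P {ω | ¬ E n ω}) atTop (𝓝 0)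

end DecentralizedEL

end

/-! On stacked families the penalty vanishes and the lasso objective is the global one, so it
suffices to show that lasso minimizers have zero total variation and that stacking a global
minimizer gives a lasso minimizer. In a connected network the total variation bounds every
disagreement `‖Lam i - Lam k‖` (`norm_sub_le_totalVariation`). Hence the first-order gain from
letting the nodes disagree is at most twice the sum of the score norms times the total variation,
while the penalty charges `η` times the total variation. Once `η` exceeds twice the sum of the score
norms, disagreement cannot pay.

In the first regime the scores are bounded at every minimizer. Stationarity under scaling forces the
weights `(1 + ⟪lam, y⟫)⁻¹` to sum to at most `N`, so the score norms sum to at most `N ∑ ‖y‖`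
(`sameSolutions_of_sum_norm_lt`), and Markov's inequality makes this of order `N²`. The equality of
solution sets needs neither existence nor uniqueness; these follow from compactness and strict
convexity when no closed half-space through the origin contains the sample (`NoHalfSpace`).

In the second regime convexity reduces everything to the scores at the global minimizer
(`globalObj_add_le_lassoObj`). The classical empirical likelihood argument gives `‖lam‖ =
O(N^{-1/2})` (`norm_globalArgmin_le`), and expanding each score together with Cauchy–Schwarz over
the nodes bounds the sum of their norms by a multiple of `K √n`. The factor `√(log K)` only has to
be bounded below when `K ≥ 2`; for `K = 1` the single score is zero. The sample properties used are
collected in `RegularSample`, and `exists_regularSample` shows that they hold with high probability,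
treating `g (·, θ_n)` as a mean-square perturbation of `g (·, θ₀)`. -/

namespace DecentralizedEL

/-! ### Total variation along the edges of a connected graph -/

section Network

open Classical in
/-- The total variation of a family of vectors along the edges of a graph. -/
noncomputable def totalVariation {V F : Type*} [Fintype V] [LinearOrder V] [NormedAddCommGroup F]
    (G : SimpleGraph V) (f : V → F) : ℝ :=
  ∑ i, ∑ k with G.Adj i k ∧ i < k, ‖f i - f k‖

variable {V F : Type*} [NormedAddCommGroup F]

/-- The length of an edge with respect to a family of vectors. -/
noncomputable def edgeLength (f : V → F) : Sym2 V → ℝ :=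
  Sym2.lift ⟨fun i k => ‖f i - f k‖, fun i k => norm_sub_rev (f i) (f k)⟩

lemma norm_sub_le_sum_edges {G : SimpleGraph V} (f : V → F) {i k : V} (p : G.Walk i k) :
    ‖f i - f k‖ ≤ (p.edges.map (edgeLength f)).sum := by
  induction p with
  | nil => simp
  | cons h p ih =>
    simp only [SimpleGraph.Walk.edges_cons, List.map_cons, List.sum_cons]
    refine (norm_sub_le_norm_sub_add_norm_sub _ _ _).trans (add_le_add le_rfl ih)

variable [Fintype V] [LinearOrder V]

lemma totalVariation_nonneg (G : SimpleGraph V) (f : V → F) : 0 ≤ totalVariation G f :=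
  Finset.sum_nonneg fun _ _ => Finset.sum_nonneg fun _ _ => norm_nonneg _

lemma totalVariation_const (G : SimpleGraph V) (a : F) :
    totalVariation G (fun _ => a) = 0 := by
  simp [totalVariation]

-- The triangle inequality along a path joining the two vertices. A path repeats no edge, so its
-- edge lengths form part of the total variation; along a general walk this would fail.
open Classical in
lemma norm_sub_le_totalVariation {G : SimpleGraph V} (hG : G.Connected) (f : V → F) (i k : V) :
    ‖f i - f k‖ ≤ totalVariation G f := by
  obtain ⟨p, hp⟩ := hG.exists_isPath i k
  refine (norm_sub_le_sum_edges f p).trans ?_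
  have hnd : p.edges.Nodup := hp.isTrail.edges_nodup
  rw [← List.sum_toFinset _ hnd]
  set S : Finset (V × V) := Finset.univ.filter fun q => G.Adj q.1 q.2 ∧ q.1 < q.2 with hS
  have hTV : totalVariation G f = ∑ q ∈ S, edgeLength f s(q.1, q.2) := by
    rw [hS, Finset.sum_filter, Fintype.sum_prod_type]
    simp [totalVariation, Finset.sum_filter, edgeLength]
  -- The order condition selects one orientation of each edge, so ordered pairs and edges
  -- correspond.
  have hinj : Set.InjOn (fun q : V × V => s(q.1, q.2)) S := by
    rintro ⟨a, b⟩ hab ⟨a', b'⟩ hab' h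
    simp only [hS, Finset.coe_filter, Finset.mem_univ, true_and, Set.mem_ofPred_eq] at hab hab'
    simp only [Sym2.eq_iff] at h
    rcases h with ⟨rfl, rfl⟩ | ⟨rfl, rfl⟩
    · rfl
    · exact absurd hab.2 (lt_asymm hab'.2)
  rw [hTV, ← Finset.sum_image (g := fun q : V × V => s(q.1, q.2)) (f := edgeLength f) hinj]
  refine Finset.sum_le_sum_of_subset_of_nonneg ?_ ?_
  · intro e he
    have he' : e ∈ G.edgeSet := p.edges_subset_edgeSet (List.mem_toFinset.1 he)
    induction e with
    | _ a b =>
      have hab : G.Adj a b := he'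
      rcases lt_or_gt_of_ne hab.ne with h | h
      · exact Finset.mem_image.2 ⟨(a, b), by simp [hS, hab, h], rfl⟩
      · exact Finset.mem_image.2 ⟨(b, a), by simp [hS, hab.symm, h], Sym2.eq_swap⟩
  · intro e _ _
    induction e with
    | _ a b => exact norm_nonneg (f a - f b)

/-- The penalty is not differentiable in general. Along these directions all differences scale by a
common factor, so it becomes smooth near `t = 0` and a derivative test is available. -/
lemma totalVariation_add_smul [NormedSpace ℝ F] (G : SimpleGraph V) (f v : V → F) (c t : ℝ)
    (h : ∀ i k, v i - v k = c • (f i - f k)) :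
    totalVariation G (fun i => f i + t • v i) = |1 + t * c| * totalVariation G f := by
  simp only [totalVariation, Finset.mul_sum]
  refine Finset.sum_congr rfl fun i _ => Finset.sum_congr rfl fun k _ => ?_
  have : f i + t • v i - (f k + t • v k) = (1 + t * c) • (f i - f k) := by
    rw [add_smul, one_smul, mul_smul, ← h, smul_sub]; abel
  rw [this, norm_smul, Real.norm_eq_abs]

end Network

/-! ### Convexity, stationarity and the deterministic consensus criteria -/

section Objective

variable {K n r : ℕ}

/-- Half of the negative gradient of the local objective. -/
noncomputable def localScore (y : Fin n → EuclideanSpace ℝ (Fin r))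
    (lam : EuclideanSpace ℝ (Fin r)) : EuclideanSpace ℝ (Fin r) :=
  ∑ j, (1 + ⟪lam, y j⟫)⁻¹ • y j

lemma lassoObj_eq (G : SimpleGraph (Fin K)) (η : ℝ) (y : Fin K → Fin n → EuclideanSpace ℝ (Fin r))
    (Lam : Fin K → EuclideanSpace ℝ (Fin r)) :
    lassoObj G η y Lam = ∑ i, localObj (y i) (Lam i) + η * totalVariation G Lam := by
  simp only [lassoObj, totalVariation, Finset.mul_sum]

lemma inner_localScore (y : Fin n → EuclideanSpace ℝ (Fin r)) (lam v : EuclideanSpace ℝ (Fin r)) :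
    ⟪localScore y lam, v⟫ = ∑ j, ⟪v, y j⟫ / (1 + ⟪lam, y j⟫) := by
  rw [localScore, sum_inner]
  refine Finset.sum_congr rfl fun j _ => ?_
  rw [real_inner_smul_left, real_inner_comm (y j) v, div_eq_inv_mul]

lemma log_sub_log_le {a b : ℝ} (ha : 0 < a) (hb : 0 < b) :
    Real.log b - Real.log a ≤ (b - a) / a := by
  have h := Real.log_le_sub_one_of_pos (div_pos hb ha)
  rw [Real.log_div hb.ne' ha.ne'] at h
  rwa [sub_div, div_self ha.ne']

lemma log_sub_log_lt {a b : ℝ} (ha : 0 < a) (hb : 0 < b) (hab : b ≠ a) :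
    Real.log b - Real.log a < (b - a) / a := by
  have h := Real.log_lt_sub_one_of_pos (div_pos hb ha)
    (fun h => hab (by rwa [div_eq_one_iff_eq ha.ne'] at h))
  rw [Real.log_div hb.ne' ha.ne'] at h
  rwa [sub_div, div_self ha.ne']

/-- The tangent inequality for the convex function `localObj y`. -/
lemma localObj_tangent_le {y : Fin n → EuclideanSpace ℝ (Fin r)}
    {lam lam' : EuclideanSpace ℝ (Fin r)} (h : lam ∈ localDomain y) (h' : lam' ∈ localDomain y) :
    localObj y lam - 2 * ⟪localScore y lam, lam' - lam⟫ ≤ localObj y lam' := by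
  have key : ∑ j, (Real.log (1 + ⟪lam', y j⟫) - Real.log (1 + ⟪lam, y j⟫)) ≤
      ∑ j, ⟪lam' - lam, y j⟫ / (1 + ⟪lam, y j⟫) := by
    refine Finset.sum_le_sum fun j _ => (log_sub_log_le (h j) (h' j)).trans_eq ?_
    rw [inner_sub_left]; ring
  rw [Finset.sum_sub_distrib] at key
  rw [inner_localScore, localObj, localObj]
  linarith

lemma localObj_tangent_lt {y : Fin n → EuclideanSpace ℝ (Fin r)}
    {lam lam' : EuclideanSpace ℝ (Fin r)} (h : lam ∈ localDomain y) (h' : lam' ∈ localDomain y)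
    (hne : ∃ j, ⟪lam' - lam, y j⟫ ≠ 0) :
    localObj y lam - 2 * ⟪localScore y lam, lam' - lam⟫ < localObj y lam' := by
  obtain ⟨j₀, hj₀⟩ := hne
  have hr : ∀ j, ((1 + ⟪lam', y j⟫) - (1 + ⟪lam, y j⟫)) / (1 + ⟪lam, y j⟫) =
      ⟪lam' - lam, y j⟫ / (1 + ⟪lam, y j⟫) := fun j => by
    rw [inner_sub_left]; ring
  have key : ∑ j, (Real.log (1 + ⟪lam', y j⟫) - Real.log (1 + ⟪lam, y j⟫)) <
      ∑ j, ⟪lam' - lam, y j⟫ / (1 + ⟪lam, y j⟫) := by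
    refine Finset.sum_lt_sum (fun j _ => (log_sub_log_le (h j) (h' j)).trans_eq (hr j))
      ⟨j₀, Finset.mem_univ _, (log_sub_log_lt (h j₀) (h' j₀) fun he => hj₀ ?_).trans_eq (hr j₀)⟩
    rw [inner_sub_left]; linarith
  rw [Finset.sum_sub_distrib] at key
  rw [inner_localScore, localObj, localObj]
  linarith

lemma hasDerivAt_localObj {y : Fin n → EuclideanSpace ℝ (Fin r)}
    {lam : EuclideanSpace ℝ (Fin r)} (h : lam ∈ localDomain y) (v : EuclideanSpace ℝ (Fin r)) :
    HasDerivAt (fun t : ℝ => localObj y (lam + t • v)) (-2 * ⟪localScore y lam, v⟫) 0 := by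
  rw [inner_localScore]
  refine HasDerivAt.const_mul (-2 : ℝ) (HasDerivAt.fun_sum fun j _ => ?_)
  have h1 : HasDerivAt (fun t : ℝ => 1 + ⟪lam + t • v, y j⟫) ⟪v, y j⟫ 0 := by
    simp only [inner_add_left, real_inner_smul_left]
    simpa using (((hasDerivAt_id (0 : ℝ)).mul_const ⟪v, y j⟫).const_add ⟪lam, y j⟫).const_add 1
  have h2 := h1.log (by simpa using (h j).ne')
  simpa using h2

lemma hasDerivAt_sum_localObj {y : Fin K → Fin n → EuclideanSpace ℝ (Fin r)}
    {Lam : Fin K → EuclideanSpace ℝ (Fin r)} (h : Lam ∈ lassoDomain y)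
    (v : Fin K → EuclideanSpace ℝ (Fin r)) :
    HasDerivAt (fun t : ℝ => ∑ i, localObj (y i) (Lam i + t • v i))
      (-2 * ∑ i, ⟪localScore (y i) (Lam i), v i⟫) 0 := by
  rw [Finset.mul_sum]
  exact HasDerivAt.fun_sum fun i _ => hasDerivAt_localObj (h i) (v i)

lemma eventually_add_smul_mem_lassoDomain {y : Fin K → Fin n → EuclideanSpace ℝ (Fin r)}
    {Lam : Fin K → EuclideanSpace ℝ (Fin r)} (h : Lam ∈ lassoDomain y)
    (v : Fin K → EuclideanSpace ℝ (Fin r)) :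
    ∀ᶠ t : ℝ in 𝓝 0, (fun i => Lam i + t • v i) ∈ lassoDomain y := by
  simp only [lassoDomain, localDomain, Set.mem_ofPred_eq]
  refine eventually_all.2 fun i => eventually_all.2 fun j => ?_
  have hc : Continuous fun t : ℝ => 1 + ⟪Lam i + t • v i, y i j⟫ := by fun_prop
  refine hc.tendsto 0 |>.eventually (lt_mem_nhds ?_)
  simpa using h i j

/-- First order condition for the fused-lasso problem, along directions in which the penalty is
homogeneous. -/
lemma lassoArgmin_stationary {G : SimpleGraph (Fin K)} {η : ℝ}
    {y : Fin K → Fin n → EuclideanSpace ℝ (Fin r)} {Lam : Fin K → EuclideanSpace ℝ (Fin r)}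
    (h : Lam ∈ lassoArgmin G η y) (v : Fin K → EuclideanSpace ℝ (Fin r)) (c : ℝ)
    (hv : ∀ i k, v i - v k = c • (Lam i - Lam k)) :
    2 * ∑ i, ⟪localScore (y i) (Lam i), v i⟫ = c * (η * totalVariation G Lam) := by
  -- For such `t` the absolute value in the scaled penalty disappears and the penalty is affine in
  -- `t`.
  have hev : ∀ᶠ t : ℝ in 𝓝 0, 0 < 1 + t * c := by
    have hc : Continuous fun t : ℝ => 1 + t * c := by fun_prop
    exact hc.tendsto 0 |>.eventually (lt_mem_nhds (by simp))
  have hlin : HasDerivAt (fun t : ℝ => (1 + t * c) * (η * totalVariation G Lam))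
      (c * (η * totalVariation G Lam)) 0 := by
    simpa using (((hasDerivAt_id (0 : ℝ)).mul_const c).const_add 1).mul_const
      (η * totalVariation G Lam)
  have hd := (hasDerivAt_sum_localObj h.1 v).add hlin
  have hmin : IsLocalMin ((fun t : ℝ => ∑ i, localObj (y i) (Lam i + t • v i)) +
      fun t : ℝ => (1 + t * c) * (η * totalVariation G Lam)) 0 := by
    filter_upwards [hev, eventually_add_smul_mem_lassoDomain h.1 v] with t ht hdom
    have := h.2 hdom
    simp only [Set.mem_ofPred_eq, lassoObj_eq, totalVariation_add_smul G Lam v c t hv,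
      abs_of_pos ht] at this
    simp only [Pi.add_apply, zero_smul, add_zero, zero_mul, one_mul]
    linarith
  linarith [hmin.hasDerivAt_eq_zero hd]

lemma globalArgmin_stationary {y : Fin K → Fin n → EuclideanSpace ℝ (Fin r)}
    {lam : EuclideanSpace ℝ (Fin r)} (h : lam ∈ globalArgmin y) :
    ∑ i, localScore (y i) lam = 0 := by
  refine ext_inner_right ℝ fun v => ?_
  rw [sum_inner, inner_zero_left]
  have hd := hasDerivAt_sum_localObj (Lam := fun _ => lam) (y := y) h.1 fun _ => v
  have hmin : IsLocalMin (fun t : ℝ => ∑ i, localObj (y i) (lam + t • v)) 0 := by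
    filter_upwards [eventually_add_smul_mem_lassoDomain (Lam := fun _ => lam) (y := y) h.1
      fun _ => v] with t hdom
    have := h.2 hdom
    simpa [globalObj] using this
  linarith [hmin.hasDerivAt_eq_zero hd]

lemma totalVariation_stack (G : SimpleGraph (Fin K)) (lam : EuclideanSpace ℝ (Fin r)) :
    totalVariation G (stack K lam) = 0 :=
  totalVariation_const G lam

lemma lassoObj_stack (G : SimpleGraph (Fin K)) (η : ℝ)
    (y : Fin K → Fin n → EuclideanSpace ℝ (Fin r)) (lam : EuclideanSpace ℝ (Fin r)) :
    lassoObj G η y (stack K lam) = globalObj y lam := by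
  rw [lassoObj_eq, totalVariation_stack, mul_zero, add_zero]
  rfl

lemma mem_globalArgmin_of_stack {G : SimpleGraph (Fin K)} {η : ℝ}
    {y : Fin K → Fin n → EuclideanSpace ℝ (Fin r)} {lam : EuclideanSpace ℝ (Fin r)}
    (h : stack K lam ∈ lassoArgmin G η y) : lam ∈ globalArgmin y := by
  refine ⟨h.1, fun mu hmu => ?_⟩
  have := h.2 (show stack K mu ∈ lassoDomain y from hmu)
  simpa [lassoObj_stack] using this

/-- A minimizer of the penalized problem with vanishing total variation is a stacked vector. -/
lemma mem_stack_image_of_totalVariation {G : SimpleGraph (Fin K)} (hG : G.Connected) {η : ℝ}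
    {y : Fin K → Fin n → EuclideanSpace ℝ (Fin r)} {Lam : Fin K → EuclideanSpace ℝ (Fin r)}
    (h : Lam ∈ lassoArgmin G η y) (hTV : totalVariation G Lam ≤ 0) :
    Lam ∈ stack K '' globalArgmin y := by
  obtain ⟨i₀⟩ := hG.nonempty
  have hst : stack K (Lam i₀) = Lam := by
    funext i
    have := (norm_sub_le_totalVariation hG Lam i₀ i).trans hTV
    exact sub_eq_zero.1 (norm_le_zero_iff.1 this)
  exact ⟨Lam i₀, mem_globalArgmin_of_stack (hst.symm ▸ h), hst⟩

lemma sum_inner_sub_le {G : SimpleGraph (Fin K)} (hG : G.Connected)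
    (s Lam : Fin K → EuclideanSpace ℝ (Fin r)) (i₀ : Fin K) :
    |∑ i, ⟪s i, Lam i - Lam i₀⟫| ≤ (∑ i, ‖s i‖) * totalVariation G Lam := by
  refine (Finset.abs_sum_le_sum_abs _ _).trans ?_
  rw [Finset.sum_mul]
  refine Finset.sum_le_sum fun i _ => (abs_real_inner_le_norm _ _).trans ?_
  exact mul_le_mul_of_nonneg_left (norm_sub_le_totalVariation hG Lam i i₀) (norm_nonneg _)

/-- If the tuning parameter dominates the scores at the global multiplier, the fused-lasso
objective exceeds the global minimum by at least a multiple of the total variation. -/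
lemma globalObj_add_le_lassoObj {G : SimpleGraph (Fin K)} (hG : G.Connected) {η : ℝ}
    {y : Fin K → Fin n → EuclideanSpace ℝ (Fin r)} {lam : EuclideanSpace ℝ (Fin r)}
    (h : lam ∈ globalArgmin y) {Lam : Fin K → EuclideanSpace ℝ (Fin r)}
    (hLam : Lam ∈ lassoDomain y) :
    globalObj y lam + (η - 2 * ∑ i, ‖localScore (y i) lam‖) * totalVariation G Lam ≤
      lassoObj G η y Lam := by
  obtain ⟨i₀⟩ := hG.nonempty
  have h1 : ∑ i, (localObj (y i) lam - 2 * ⟪localScore (y i) lam, Lam i - lam⟫) ≤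
      ∑ i, localObj (y i) (Lam i) :=
    Finset.sum_le_sum fun i _ => localObj_tangent_le (h.1 i) (hLam i)
  rw [Finset.sum_sub_distrib, ← Finset.mul_sum] at h1
  -- The scores at the global minimizer sum to zero, so the base point may be moved from `lam` to
  -- `Lam i₀`. What remains are disagreements, which the total variation controls.
  have h2 : ∑ i, ⟪localScore (y i) lam, Lam i - lam⟫ =
      ∑ i, ⟪localScore (y i) lam, Lam i - Lam i₀⟫ := by
    rw [← sub_eq_zero, ← Finset.sum_sub_distrib]
    simp_rw [← inner_sub_right]
    have : ∀ i, Lam i - lam - (Lam i - Lam i₀) = Lam i₀ - lam := fun i => by abel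
    simp_rw [this]
    rw [← sum_inner, globalArgmin_stationary h, inner_zero_left]
  have h3 := (abs_le.1 (sum_inner_sub_le hG (fun i => localScore (y i) lam) Lam i₀)).2
  rw [lassoObj_eq]
  rw [h2] at h1
  have : globalObj y lam = ∑ i, localObj (y i) lam := rfl
  nlinarith

lemma stack_mem_lassoArgmin {G : SimpleGraph (Fin K)} (hG : G.Connected) {η : ℝ}
    {y : Fin K → Fin n → EuclideanSpace ℝ (Fin r)} {lam : EuclideanSpace ℝ (Fin r)}
    (h : lam ∈ globalArgmin y) (hs : 2 * ∑ i, ‖localScore (y i) lam‖ < η) :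
    stack K lam ∈ lassoArgmin G η y := by
  refine ⟨h.1, fun Lam hLam => ?_⟩
  have h1 := globalObj_add_le_lassoObj hG (η := η) h hLam
  have h2 := mul_nonneg (sub_nonneg.2 hs.le) (totalVariation_nonneg G Lam)
  simp only [Set.mem_ofPred_eq, lassoObj_stack]
  linarith

/-- The fused-lasso problem has the same solutions as the global one once the tuning parameter
dominates the scores at a global multiplier. -/
lemma sameSolutions_of_score_lt {G : SimpleGraph (Fin K)} (hG : G.Connected) {η : ℝ}
    {y : Fin K → Fin n → EuclideanSpace ℝ (Fin r)} {lam : EuclideanSpace ℝ (Fin r)}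
    (h : globalArgmin y = {lam}) (hs : 2 * ∑ i, ‖localScore (y i) lam‖ < η) :
    SameSolutions G η y := by
  have hlam : lam ∈ globalArgmin y := h ▸ Set.mem_singleton lam
  refine Set.Subset.antisymm (fun Lam hLam => ?_) ?_
  · refine mem_stack_image_of_totalVariation hG hLam ?_
    have h1 := globalObj_add_le_lassoObj hG (η := η) hlam hLam.1
    have h2 := hLam.2 (show stack K lam ∈ lassoDomain y from hlam.1)
    simp only [Set.mem_ofPred_eq, lassoObj_stack] at h2
    by_contra! hpos
    have := mul_pos (sub_pos.2 hs) hpos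
    linarith
  · rintro _ ⟨mu, hmu, rfl⟩
    obtain rfl : mu = lam := by simpa [h] using hmu
    exact stack_mem_lassoArgmin hG hlam hs

lemma minimizersCoincide_of_sameSolutions {G : SimpleGraph (Fin K)} {η : ℝ}
    {y : Fin K → Fin n → EuclideanSpace ℝ (Fin r)} {lam : EuclideanSpace ℝ (Fin r)}
    (h : globalArgmin y = {lam}) (hs : SameSolutions G η y) : MinimizersCoincide G η y :=
  ⟨lam, h, by rw [hs, h, Set.image_singleton]⟩

/-- The weights `(1 + ⟪lam_i, y i j⟫)⁻¹` control the scores. -/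
lemma sum_norm_localScore_le {y : Fin K → Fin n → EuclideanSpace ℝ (Fin r)}
    {Lam : Fin K → EuclideanSpace ℝ (Fin r)} (h : Lam ∈ lassoDomain y) {W : ℝ}
    (hW : ∑ i, ∑ j, (1 + ⟪Lam i, y i j⟫)⁻¹ ≤ W) :
    ∑ i, ‖localScore (y i) (Lam i)‖ ≤ W * ∑ i, ∑ j, ‖y i j‖ := by
  have hpos : ∀ i j, 0 ≤ (1 + ⟪Lam i, y i j⟫)⁻¹ := fun i j => (inv_pos.2 (h i j)).le
  rw [Finset.mul_sum]
  refine Finset.sum_le_sum fun i _ => (norm_sum_le _ _).trans ?_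
  rw [Finset.mul_sum]
  refine Finset.sum_le_sum fun j _ => ?_
  rw [norm_smul, Real.norm_of_nonneg (hpos i j)]
  refine mul_le_mul_of_nonneg_right (le_trans ?_ hW) (norm_nonneg _)
  refine le_trans ?_ (Finset.single_le_sum (f := fun i => ∑ j, (1 + ⟪Lam i, y i j⟫)⁻¹)
    (fun i _ => Finset.sum_nonneg fun j _ => hpos i j) (Finset.mem_univ i))
  exact Finset.single_le_sum (f := fun j => (1 + ⟪Lam i, y i j⟫)⁻¹) (fun j _ => hpos i j)
    (Finset.mem_univ j)

/-- This is `x / (1 + x) = 1 - (1 + x)⁻¹` summed over the sample. It turns stationarity under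
scaling into control of the total weight. -/
lemma sum_inner_localScore_self {y : Fin K → Fin n → EuclideanSpace ℝ (Fin r)}
    {Lam : Fin K → EuclideanSpace ℝ (Fin r)} (h : Lam ∈ lassoDomain y) :
    ∑ i, ⟪localScore (y i) (Lam i), Lam i⟫ =
      K * n - ∑ i, ∑ j, (1 + ⟪Lam i, y i j⟫)⁻¹ := by
  have hN : ((K : ℝ) * n) = ∑ _i : Fin K, ∑ _j : Fin n, (1 : ℝ) := by simp
  rw [hN, ← Finset.sum_sub_distrib]
  refine Finset.sum_congr rfl fun i _ => ?_
  rw [← Finset.sum_sub_distrib, inner_localScore]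
  refine Finset.sum_congr rfl fun j _ => ?_
  have := (h i j).ne'
  field_simp
  ring

/-- Deterministic form of the first regime. -/
lemma sameSolutions_of_sum_norm_lt {G : SimpleGraph (Fin K)} (hG : G.Connected) {η : ℝ}
    (hη : 0 < η) {y : Fin K → Fin n → EuclideanSpace ℝ (Fin r)}
    (hy : 2 * ((K : ℝ) * n * ∑ i, ∑ j, ‖y i j‖) < η) : SameSolutions G η y := by
  refine Set.Subset.antisymm (fun Lam hLam => ?_) ?_
  · refine mem_stack_image_of_totalVariation hG hLam ?_
    obtain ⟨i₀⟩ := hG.nonempty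
    -- Scaling direction: the pairing of the scores with `Lam` is half the penalty, hence
    -- nonnegative, so the weights sum to at most `K n`.
    have h1 := lassoArgmin_stationary hLam Lam 1 (by simp)
    rw [sum_inner_localScore_self hLam.1] at h1
    have h2 := mul_nonneg hη.le (totalVariation_nonneg G Lam)
    have h3 := sum_norm_localScore_le hLam.1 (W := K * n) (by linarith)
    -- Shrinking towards node `i₀`: the penalty equals twice the pairing of the scores with the
    -- disagreements. That is too small for a positive total variation, by `hy`.
    have h4 := lassoArgmin_stationary hLam (fun i => Lam i - Lam i₀) 1 (by simp)
    have h5 := (abs_le.1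
      (sum_inner_sub_le hG (fun i => localScore (y i) (Lam i)) Lam i₀)).2
    by_contra! hpos
    have h6 := mul_lt_mul_of_pos_right
      ((mul_le_mul_of_nonneg_left h3 zero_le_two).trans_lt hy) hpos
    nlinarith
  · rintro _ ⟨lam, hlam, rfl⟩
    refine stack_mem_lassoArgmin hG hlam (lt_of_le_of_lt ?_ hy)
    refine mul_le_mul_of_nonneg_left ?_ zero_le_two
    refine sum_norm_localScore_le (Lam := fun _ => lam) hlam.1 ?_
    have h1 := sum_inner_localScore_self (y := y) (Lam := fun _ => lam) hlam.1
    rw [← sum_inner, globalArgmin_stationary hlam, inner_zero_left] at h1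
    linarith

end Objective

/-! ### Coercivity of homogeneous functions -/

section Coercivity

/-- A continuous positively homogeneous function which is positive away from the origin of a
finite-dimensional space is coercive. -/
lemma exists_pos_mul_norm_pow_le {F : Type*} [NormedAddCommGroup F] [NormedSpace ℝ F]
    [FiniteDimensional ℝ F] {f : F → ℝ} (hf : Continuous f) {k : ℕ}
    (hom : ∀ (t : ℝ) (x : F), 0 ≤ t → f (t • x) = t ^ k * f x)
    (hpos : ∀ x, x ≠ 0 → 0 < f x) (h0 : 0 ≤ f 0) (hk : k ≠ 0) :
    ∃ c > 0, ∀ x, c * ‖x‖ ^ k ≤ f x := by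
  have : ProperSpace F := FiniteDimensional.proper ℝ F
  have key : ∃ c > 0, ∀ x ∈ Metric.sphere (0 : F) 1, c ≤ f x := by
    rcases (Metric.sphere (0 : F) 1).eq_empty_or_nonempty with he | hne
    -- The unit sphere is empty in dimension zero, where any positive constant serves.
    · exact ⟨1, one_pos, fun x hx => by simp [he] at hx⟩
    · obtain ⟨x₀, hx₀, hmin⟩ := (isCompact_sphere (0 : F) 1).exists_isMinOn hne hf.continuousOn
      refine ⟨f x₀, hpos x₀ ?_, fun x hx => hmin hx⟩
      rintro rfl
      simp at hx₀
  obtain ⟨c, hc, hcf⟩ := key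
  refine ⟨c, hc, fun x => ?_⟩
  rcases eq_or_ne x 0 with rfl | hx
  · simpa [hk] using h0
  · have hn : 0 < ‖x‖ := norm_pos_iff.2 hx
    have h1 := hcf (‖x‖⁻¹ • x) (by simp [norm_smul, hn.ne'])
    have h2 := hom ‖x‖ (‖x‖⁻¹ • x) hn.le
    rw [smul_smul, mul_inv_cancel₀ hn.ne', one_smul] at h2
    rw [h2, mul_comm]
    exact mul_le_mul_of_nonneg_left h1 (by positivity)

end Coercivity

/-! ### Existence and uniqueness of the global multiplier -/

section Existence

variable {K n r : ℕ}

/-- No closed half-space through the origin contains all the points `y i j`. -/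
def NoHalfSpace (y : Fin K → Fin n → EuclideanSpace ℝ (Fin r)) : Prop :=
  ∀ u : EuclideanSpace ℝ (Fin r), u ≠ 0 → ∃ i j, ⟪u, y i j⟫ < 0

/-- If a half-space `0 ≤ ⟪u, ·⟫` contained the points it would contain their hull, hence also `t •
u` for small negative `t`, which is absurd for `u ≠ 0`. -/
lemma ZeroInsideHull.noHalfSpace {y : Fin K → Fin n → EuclideanSpace ℝ (Fin r)}
    (h : ZeroInsideHull y) : NoHalfSpace y := by
  intro u hu
  by_contra! hge
  have hsub : convexHull ℝ (Set.range fun ij : Fin K × Fin n => y ij.1 ij.2) ⊆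
      {x | 0 ≤ ⟪u, x⟫} := by
    refine convexHull_min ?_ (convex_halfSpace_ge (innerₛₗ ℝ u).isLinear 0)
    rintro _ ⟨ij, rfl⟩
    exact hge ij.1 ij.2
  have hmem : ∀ᶠ t : ℝ in 𝓝[<] 0, t • u ∈
      convexHull ℝ (Set.range fun ij : Fin K × Fin n => y ij.1 ij.2) := by
    refine nhdsWithin_le_nhds ?_
    have hc : Continuous fun t : ℝ => t • u := by fun_prop
    refine hc.tendsto 0 |>.eventually ?_
    simpa using mem_interior_iff_mem_nhds.1 h
  obtain ⟨t, ht, hneg⟩ := (hmem.and self_mem_nhdsWithin).exists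
  have h1 : 0 ≤ ⟪u, t • u⟫ := hsub ht
  rw [real_inner_smul_right] at h1
  have h2 : 0 < ⟪u, u⟫ := real_inner_self_pos.2 hu
  exact absurd h1 (not_le.2 (mul_neg_of_neg_of_pos hneg h2))

/-- The sum of the negative parts of `⟪u, y i j⟫` is homogeneous and, without a containing
half-space, positive off the origin, so it dominates a multiple of `‖u‖`. On the closed domain each
negative part is at most `1`. -/
lemma isCompact_closedDomain {y : Fin K → Fin n → EuclideanSpace ℝ (Fin r)}
    (h : NoHalfSpace y) :
    IsCompact {lam : EuclideanSpace ℝ (Fin r) | ∀ i j, 0 ≤ 1 + ⟪lam, y i j⟫} := by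
  obtain ⟨c, hc, hcf⟩ := exists_pos_mul_norm_pow_le (k := 1)
    (f := fun u : EuclideanSpace ℝ (Fin r) => ∑ i, ∑ j, max 0 (-⟪u, y i j⟫))
    (by fun_prop)
    (fun t x ht => by
      simp only [pow_one, Finset.mul_sum, mul_max_of_nonneg _ _ ht, mul_zero,
        real_inner_smul_left, mul_neg])
    (fun x hx => by
      obtain ⟨i, j, hij⟩ := h x hx
      refine Finset.sum_pos' (fun i _ => Finset.sum_nonneg fun j _ => le_max_left _ _)
        ⟨i, Finset.mem_univ i, Finset.sum_pos' (fun j _ => le_max_left _ _)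
          ⟨j, Finset.mem_univ j, lt_max_of_lt_right (neg_pos.2 hij)⟩⟩)
    (by simp) one_ne_zero
  refine Metric.isCompact_of_isClosed_isBounded ?_ ?_
  · simp only [Set.ofPred_forall]
    exact isClosed_iInter fun i => isClosed_iInter fun j =>
      isClosed_le continuous_const (by fun_prop)
  · refine (Metric.isBounded_closedBall (x := (0 : EuclideanSpace ℝ (Fin r)))
      (r := (∑ _i : Fin K, ∑ _j : Fin n, (1 : ℝ)) / c)).subset fun lam hlam => ?_
    rw [mem_closedBall_zero_iff, le_div_iff₀' hc]
    refine (le_of_eq (by rw [pow_one])).trans ((hcf lam).trans ?_)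
    refine Finset.sum_le_sum fun i _ => Finset.sum_le_sum fun j _ => max_le zero_le_one ?_
    linarith [hlam i j]

lemma globalObj_eq_log_prod {y : Fin K → Fin n → EuclideanSpace ℝ (Fin r)}
    {lam : EuclideanSpace ℝ (Fin r)} (h : lam ∈ globalDomain y) :
    globalObj y lam = -2 * Real.log (∏ i, ∏ j, (1 + ⟪lam, y i j⟫)) := by
  rw [Real.log_prod fun i _ => Finset.prod_ne_zero_iff.2 fun j _ => (h i j).ne', Finset.mul_sum]
  refine Finset.sum_congr rfl fun i _ => ?_
  rw [localObj, Real.log_prod fun j _ => (h i j).ne']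

/-- Maximizing the product instead of the sum of logarithms gives a function continuous up to the
boundary. Its value at `0` is `1`, so no factor vanishes at a maximizer, which therefore lies in the
open domain. -/
lemma globalArgmin_nonempty {y : Fin K → Fin n → EuclideanSpace ℝ (Fin r)}
    (h : NoHalfSpace y) : (globalArgmin y).Nonempty := by
  have hc : Continuous fun lam : EuclideanSpace ℝ (Fin r) => ∏ i, ∏ j, (1 + ⟪lam, y i j⟫) := by
    fun_prop
  obtain ⟨lam, hlam, hmax⟩ := (isCompact_closedDomain h).exists_isMaxOn ⟨0, by simp⟩
    hc.continuousOn
  have h1 : 1 ≤ ∏ i, ∏ j, (1 + ⟪lam, y i j⟫) := by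
    have := hmax (show (0 : EuclideanSpace ℝ (Fin r)) ∈ _ by simp)
    simpa using this
  have hdom : lam ∈ globalDomain y := by
    intro i j
    have hne := Finset.prod_ne_zero_iff.1 (zero_lt_one.trans_le h1).ne' i (Finset.mem_univ i)
    exact (hlam i j).lt_of_ne' (Finset.prod_ne_zero_iff.1 hne j (Finset.mem_univ j))
  refine ⟨lam, hdom, fun mu hmu => ?_⟩
  have h2 : ∏ i, ∏ j, (1 + ⟪mu, y i j⟫) ≤ ∏ i, ∏ j, (1 + ⟪lam, y i j⟫) :=
    hmax (show mu ∈ _ from fun i j => (hmu i j).le)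
  have h3 : 0 < ∏ i, ∏ j, (1 + ⟪mu, y i j⟫) :=
    Finset.prod_pos fun i _ => Finset.prod_pos fun j _ => hmu i j
  simp only [Set.mem_ofPred_eq, globalObj_eq_log_prod hdom, globalObj_eq_log_prod hmu]
  linarith [Real.log_le_log h3 h2]

/-- Some sample point is not orthogonal to the difference of two distinct minimizers, and there the
tangent inequality is strict. -/
lemma globalArgmin_subsingleton {y : Fin K → Fin n → EuclideanSpace ℝ (Fin r)}
    (h : NoHalfSpace y) : (globalArgmin y).Subsingleton := by
  intro lam hlam mu hmu
  by_contra hne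
  obtain ⟨i₀, j₀, hij⟩ := h (mu - lam) (sub_ne_zero.2 (Ne.symm hne))
  have h1 : ∑ i, (localObj (y i) lam - 2 * ⟪localScore (y i) lam, mu - lam⟫) <
      ∑ i, localObj (y i) mu :=
    Finset.sum_lt_sum (fun i _ => localObj_tangent_le (hlam.1 i) (hmu.1 i))
      ⟨i₀, Finset.mem_univ _, localObj_tangent_lt (hlam.1 i₀) (hmu.1 i₀) ⟨j₀, hij.ne⟩⟩
  rw [Finset.sum_sub_distrib, ← Finset.mul_sum, ← sum_inner, globalArgmin_stationary hlam,
    inner_zero_left] at h1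
  have h2 : globalObj y mu ≤ globalObj y lam := hmu.2 hlam.1
  simp only [globalObj] at h2
  linarith

lemma NoHalfSpace.exists_globalArgmin_eq {y : Fin K → Fin n → EuclideanSpace ℝ (Fin r)}
    (h : NoHalfSpace y) : ∃ lam, globalArgmin y = {lam} :=
  Set.exists_eq_singleton_iff_nonempty_subsingleton.2
    ⟨globalArgmin_nonempty h, globalArgmin_subsingleton h⟩

lemma NoHalfSpace.minimizersCoincide {G : SimpleGraph (Fin K)} {η : ℝ}
    {y : Fin K → Fin n → EuclideanSpace ℝ (Fin r)} (h : NoHalfSpace y)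
    (hs : SameSolutions G η y) : MinimizersCoincide G η y :=
  minimizersCoincide_of_sameSolutions h.exists_globalArgmin_eq.choose_spec hs

end Existence

/-! ### Size of the multiplier and of the scores for a regular sample -/

section Rate

variable {K n r : ℕ}

lemma sum_inner_sum (y : Fin K → Fin n → EuclideanSpace ℝ (Fin r))
    (u : EuclideanSpace ℝ (Fin r)) :
    ⟪u, ∑ i, ∑ j, y i j⟫ = ∑ i, ∑ j, ⟪u, y i j⟫ := by
  simp only [inner_sum]

/-- If the points are small compared with the spread of the sample and their sum is small, they
are not contained in a half-space. -/
lemma noHalfSpace_of_moment_bounds {y : Fin K → Fin n → EuclideanSpace ℝ (Fin r)} {M a : ℝ}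
    (hM : ∀ i j, ‖y i j‖ ≤ M) (hM0 : 0 ≤ M)
    (ha : ∀ u : EuclideanSpace ℝ (Fin r), a * ‖u‖ ^ 2 ≤ ∑ i, ∑ j, ⟪u, y i j⟫ ^ 2)
    (hsum : M * ‖∑ i, ∑ j, y i j‖ < a) : NoHalfSpace y := by
  intro u hu
  by_contra! hge
  have hn : 0 < ‖u‖ := norm_pos_iff.2 hu
  -- In a half-space all `⟪u, y i j⟫` are nonnegative, so one factor of each square can be bounded
  -- by `‖u‖ * M` and the other summed linearly.
  have h1 : ∑ i, ∑ j, ⟪u, y i j⟫ ^ 2 ≤ (‖u‖ * M) * ⟪u, ∑ i, ∑ j, y i j⟫ := by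
    rw [sum_inner_sum, Finset.mul_sum]
    refine Finset.sum_le_sum fun i _ => ?_
    rw [Finset.mul_sum]
    refine Finset.sum_le_sum fun j _ => ?_
    rw [sq]
    refine mul_le_mul_of_nonneg_right ((real_inner_le_norm _ _).trans ?_) (hge i j)
    exact mul_le_mul_of_nonneg_left (hM i j) hn.le
  have h2 : (‖u‖ * M) * ⟪u, ∑ i, ∑ j, y i j⟫ ≤ (‖u‖ * M) * (‖u‖ * ‖∑ i, ∑ j, y i j‖) :=
    mul_le_mul_of_nonneg_left (real_inner_le_norm _ _) (by positivity)
  have h3 := mul_lt_mul_of_pos_right hsum (pow_pos hn 2)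
  have h4 := ha u
  nlinarith

/-- A bound for the norm of the global multiplier. -/
lemma norm_globalArgmin_le {y : Fin K → Fin n → EuclideanSpace ℝ (Fin r)} {M a : ℝ}
    {lam : EuclideanSpace ℝ (Fin r)} (hlam : lam ∈ globalArgmin y)
    (hM : ∀ i j, ‖y i j‖ ≤ M) (hM0 : 0 ≤ M)
    (ha : ∀ u : EuclideanSpace ℝ (Fin r), a * ‖u‖ ^ 2 ≤ ∑ i, ∑ j, ⟪u, y i j⟫ ^ 2)
    (hsum : M * ‖∑ i, ∑ j, y i j‖ ≤ a / 2) :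
    a / 2 * ‖lam‖ ≤ ‖∑ i, ∑ j, y i j‖ := by
  rcases eq_or_ne lam 0 with rfl | hne
  · simp
  have hn : 0 < ‖lam‖ := norm_pos_iff.2 hne
  have hstat : ∑ i, ∑ j, ⟪lam, y i j⟫ / (1 + ⟪lam, y i j⟫) = 0 := by
    simp_rw [← inner_localScore]
    rw [← sum_inner, globalArgmin_stationary hlam, inner_zero_left]
  -- Stationarity combined with `x - x / (1 + x) = x² / (1 + x)`: a weighted quadratic form in `lam`
  -- equals a linear one.
  have h1 : ∑ i, ∑ j, ⟪lam, y i j⟫ ^ 2 / (1 + ⟪lam, y i j⟫) = ⟪lam, ∑ i, ∑ j, y i j⟫ := by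
    rw [sum_inner_sum, ← sub_zero (∑ i, ∑ j, ⟪lam, y i j⟫), ← hstat, ← Finset.sum_sub_distrib]
    refine Finset.sum_congr rfl fun i _ => ?_
    rw [← Finset.sum_sub_distrib]
    refine Finset.sum_congr rfl fun j _ => ?_
    have := (hlam.1 i j).ne'
    field_simp
    ring
  have h2 : ∑ i, ∑ j, ⟪lam, y i j⟫ ^ 2 ≤
      (1 + ‖lam‖ * M) * ∑ i, ∑ j, ⟪lam, y i j⟫ ^ 2 / (1 + ⟪lam, y i j⟫) := by
    rw [Finset.mul_sum]
    refine Finset.sum_le_sum fun i _ => ?_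
    rw [Finset.mul_sum]
    refine Finset.sum_le_sum fun j _ => ?_
    have hp := hlam.1 i j
    have hle : 1 + ⟪lam, y i j⟫ ≤ 1 + ‖lam‖ * M := by
      have := (real_inner_le_norm lam (y i j)).trans (mul_le_mul_of_nonneg_left (hM i j) hn.le)
      linarith
    rw [← mul_div_assoc, le_div_iff₀ hp, mul_comm]
    exact mul_le_mul_of_nonneg_right hle (sq_nonneg _)
  rw [h1] at h2
  have h3 : (1 + ‖lam‖ * M) * ⟪lam, ∑ i, ∑ j, y i j⟫ ≤
      (1 + ‖lam‖ * M) * (‖lam‖ * ‖∑ i, ∑ j, y i j‖) :=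
    mul_le_mul_of_nonneg_left (real_inner_le_norm _ _) (by positivity)
  have h4 := (ha lam).trans (h2.trans h3)
  have h5 : a * ‖lam‖ ≤ (1 + ‖lam‖ * M) * ‖∑ i, ∑ j, y i j‖ :=
    le_of_mul_le_mul_right (by linarith) hn
  -- By `hsum` the term `‖lam‖ * M * ‖∑ y‖` is at most `a / 2 * ‖lam‖` and is absorbed on the left.
  nlinarith

/-- Write `(1 + x)⁻¹ = 1 - x / (1 + x)`. The first part gives the plain sum; in the second the
denominators are at least `1 / 2`, whence the factor `2`. -/
lemma norm_localScore_le {y : Fin n → EuclideanSpace ℝ (Fin r)} {M : ℝ}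
    {lam : EuclideanSpace ℝ (Fin r)} (hM : ∀ j, ‖y j‖ ≤ M) (hsmall : ‖lam‖ * M ≤ 1 / 2) :
    ‖localScore y lam‖ ≤ ‖∑ j, y j‖ + 2 * ‖lam‖ * ∑ j, ‖y j‖ ^ 2 := by
  have hin : ∀ j, |⟪lam, y j⟫| ≤ ‖lam‖ * ‖y j‖ := fun j => abs_real_inner_le_norm _ _
  have hhalf : ∀ j, 1 / 2 ≤ 1 + ⟪lam, y j⟫ := fun j => by
    have h1 := (abs_le.1 (hin j)).1
    have h2 := mul_le_mul_of_nonneg_left (hM j) (norm_nonneg lam)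
    linarith
  have hd : localScore y lam = ∑ j, y j - ∑ j, (⟪lam, y j⟫ / (1 + ⟪lam, y j⟫)) • y j := by
    rw [localScore, ← Finset.sum_sub_distrib]
    refine Finset.sum_congr rfl fun j _ => ?_
    have hne : 1 + ⟪lam, y j⟫ ≠ 0 := by linarith [hhalf j]
    rw [← one_smul ℝ (y j), smul_smul, smul_smul, ← sub_smul, one_smul]
    congr 1
    field_simp
    ring
  rw [hd, Finset.mul_sum]
  refine (norm_sub_le _ _).trans (add_le_add le_rfl ((norm_sum_le _ _).trans ?_))
  refine Finset.sum_le_sum fun j _ => ?_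
  have hp : 0 < 1 + ⟪lam, y j⟫ := by linarith [hhalf j]
  rw [norm_smul, norm_div, Real.norm_eq_abs, Real.norm_of_nonneg hp.le, sq, ← mul_assoc]
  refine mul_le_mul_of_nonneg_right ?_ (norm_nonneg _)
  rw [div_le_iff₀ hp]
  have h1 := mul_nonneg (norm_nonneg lam) (norm_nonneg (y j))
  nlinarith [hin j, hhalf j]

/-- A sample of size `K n` whose first two moments behave as expected. -/
structure RegularSample (c B δ : ℝ) (y : Fin K → Fin n → EuclideanSpace ℝ (Fin r)) : Prop where
  spread : ∀ u : EuclideanSpace ℝ (Fin r),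
    c * (K * n) * ‖u‖ ^ 2 ≤ ∑ i, ∑ j, ⟪u, y i j⟫ ^ 2
  norm_sum : ‖∑ i, ∑ j, y i j‖ ^ 2 ≤ B ^ 2 * (K * n)
  sum_sq_norm : ∑ i, ‖∑ j, y i j‖ ^ 2 ≤ B ^ 2 * (K * n)
  sum_sq : ∑ i, ∑ j, ‖y i j‖ ^ 2 ≤ B ^ 2 * (K * n)
  norm_le : ∀ i j, ‖y i j‖ ≤ δ * √(K * n)

variable {c B δ : ℝ} {y : Fin K → Fin n → EuclideanSpace ℝ (Fin r)}

lemma RegularSample.norm_sum_le (h : RegularSample c B δ y) (hB : 0 ≤ B) :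
    ‖∑ i, ∑ j, y i j‖ ≤ B * √(K * n) := by
  refine abs_le_of_sq_le_sq' ?_ (by positivity) |>.2
  rw [mul_pow, Real.sq_sqrt (by positivity)]
  exact h.norm_sum

lemma RegularSample.max_mul_norm_sum_le (h : RegularSample c B δ y) (hB : 0 ≤ B) (hδ : 0 ≤ δ)
    (hδB : δ * B ≤ c / 4) : δ * √(K * n) * ‖∑ i, ∑ j, y i j‖ ≤ c * (K * n) / 4 := by
  have h1 := mul_le_mul_of_nonneg_left (h.norm_sum_le hB)
    (show 0 ≤ δ * √((K : ℝ) * n) by positivity)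
  have h2 : √((K : ℝ) * n) * √(K * n) = K * n := Real.mul_self_sqrt (by positivity)
  have h3 : δ * √((K : ℝ) * n) * (B * √(K * n)) = δ * B * (K * n) := by
    linear_combination (δ * B) * h2
  have h4 := mul_le_mul_of_nonneg_right hδB (show 0 ≤ (K : ℝ) * n by positivity)
  linarith

lemma RegularSample.noHalfSpace (h : RegularSample c B δ y) (hB : 0 ≤ B) (hδ : 0 ≤ δ)
    (hc : 0 < c) (hδB : δ * B ≤ c / 4) (hN : 0 < (K : ℝ) * n) : NoHalfSpace y := by
  refine noHalfSpace_of_moment_bounds h.norm_le (by positivity) h.spread ?_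
  have := mul_pos hc hN
  linarith [h.max_mul_norm_sum_le hB hδ hδB]

lemma RegularSample.sum_norm_localScore_le (h : RegularSample c B δ y) (hB : 0 ≤ B) (hδ : 0 ≤ δ)
    (hc : 0 < c) (hδB : δ * B ≤ c / 4) (hN : 0 < (K : ℝ) * n)
    {lam : EuclideanSpace ℝ (Fin r)} (hlam : lam ∈ globalArgmin y) :
    ∑ i, ‖localScore (y i) lam‖ ≤ (B + 4 * B ^ 3 / c) * (K * √n) := by
  set N : ℝ := (K : ℝ) * n with hNdef
  have hs : 0 < √N := Real.sqrt_pos.2 hN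
  have hss : √N * √N = N := Real.mul_self_sqrt hN.le
  have hcN : 0 < c * N := mul_pos hc hN
  have h1 := norm_globalArgmin_le hlam h.norm_le (by positivity) h.spread
    (by linarith [h.max_mul_norm_sum_le hB hδ hδB])
  -- The multiplier is of order `N^{-1/2}`.
  have h2 : ‖lam‖ * √N ≤ 2 * B / c := by
    rw [le_div_iff₀ hc]
    have h2 := h1.trans (h.norm_sum_le hB)
    rw [← hNdef] at h2
    have h3 : (‖lam‖ * √N * c) * √N ≤ (2 * B) * √N := by
      linear_combination 2 * h2 + c * ‖lam‖ * hss
    exact le_of_mul_le_mul_right h3 hs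
  -- The condition `δ * B ≤ c / 4` is exactly what keeps all `⟪lam, y i j⟫` within `1 / 2` of zero.
  have h3 : ‖lam‖ * (δ * √N) ≤ 1 / 2 := by
    have h4 := mul_le_mul_of_nonneg_left h2 hδ
    have h5 : δ * (2 * B / c) ≤ 1 / 2 := by
      rw [← mul_div_assoc, div_le_iff₀ hc]; linarith
    linarith
  have h4 : ∑ i, ‖localScore (y i) lam‖ ≤
      ∑ i, ‖∑ j, y i j‖ + 2 * ‖lam‖ * ∑ i, ∑ j, ‖y i j‖ ^ 2 := by
    rw [Finset.mul_sum, ← Finset.sum_add_distrib]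
    exact Finset.sum_le_sum fun i _ => norm_localScore_le (h.norm_le i) h3
  have hKn : K * √n = √(K * N) := by
    rw [hNdef, ← mul_assoc, Real.sqrt_mul (by positivity), Real.sqrt_mul_self (by positivity)]
  -- Cauchy–Schwarz over the `K` nodes.
  have h5 : ∑ i, ‖∑ j, y i j‖ ≤ B * (K * √n) := by
    rw [hKn]
    refine abs_le_of_sq_le_sq' ?_ (by positivity) |>.2
    rw [mul_pow, Real.sq_sqrt (by positivity)]
    have := sq_sum_le_card_mul_sum_sq (s := (Finset.univ : Finset (Fin K)))
      (f := fun i => ‖∑ j, y i j‖)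
    rw [Finset.card_univ, Fintype.card_fin] at this
    have h6 := mul_le_mul_of_nonneg_left h.sum_sq_norm (show 0 ≤ (K : ℝ) by positivity)
    linarith
  have h6 : √N ≤ K * √n := by
    rw [hKn]
    have hK : (1 : ℝ) ≤ K := by
      rcases Nat.eq_zero_or_pos K with rfl | hK
      · simp [hNdef] at hN
      · exact_mod_cast hK
    exact Real.sqrt_le_sqrt (by nlinarith)
  have h7 : 2 * ‖lam‖ * ∑ i, ∑ j, ‖y i j‖ ^ 2 ≤ 4 * B ^ 3 / c * (K * √n) := by
    have h8 := mul_le_mul_of_nonneg_left h.sum_sq (show 0 ≤ 2 * ‖lam‖ by positivity)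
    have h9 : 2 * ‖lam‖ * (B ^ 2 * N) = 2 * B ^ 2 * √N * (‖lam‖ * √N) := by
      linear_combination (-(2 * ‖lam‖ * B ^ 2)) * hss
    have h10 := mul_le_mul_of_nonneg_left h2 (show 0 ≤ 2 * B ^ 2 * √N by positivity)
    have h11 : 2 * B ^ 2 * √N * (2 * B / c) = 4 * B ^ 3 / c * √N := by ring
    have h12 := mul_le_mul_of_nonneg_left h6 (show 0 ≤ 4 * B ^ 3 / c by positivity)
    linarith
  linarith

/-- Deterministic form of the second regime. -/
lemma RegularSample.minimizersCoincide (h : RegularSample c B δ y) (hB : 0 ≤ B) (hδ : 0 ≤ δ)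
    (hc : 0 < c) (hδB : δ * B ≤ c / 4) (hN : 0 < (K : ℝ) * n)
    {G : SimpleGraph (Fin K)} (hG : G.Connected) {η : ℝ} (hη : 0 < η)
    (hηK : 1 < K → 2 * ((B + 4 * B ^ 3 / c) * (K * √n)) < η) : MinimizersCoincide G η y := by
  obtain ⟨lam, hlam⟩ := (h.noHalfSpace hB hδ hc hδB hN).exists_globalArgmin_eq
  refine minimizersCoincide_of_sameSolutions hlam (sameSolutions_of_score_lt hG hlam ?_)
  have hmem : lam ∈ globalArgmin y := hlam ▸ Set.mem_singleton lam
  rcases lt_or_ge 1 K with hK | hK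
  · have := h.sum_norm_localScore_le hB hδ hc hδB hN hmem
    linarith [hηK hK]
  -- With a single node the local score is the total score, which vanishes, so positivity of `η`
  -- suffices.
  · have hsub : Subsingleton (Fin K) := Fin.subsingleton_iff_le_one.2 hK
    have h0 := globalArgmin_stationary hmem
    have h1 : ∑ i, ‖localScore (y i) lam‖ = 0 := by
      refine Finset.sum_eq_zero fun i _ => ?_
      rw [Fintype.sum_subsingleton _ i] at h0
      rw [h0, norm_zero]
    rwa [h1, mul_zero]

end Rate

/-! ### Moments of sums of i.i.d. variables -/

section IIDSums

variable {Ω α ι : Type*} [MeasurableSpace Ω] [MeasurableSpace α] {P : Measure Ω}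
  {μ : Measure α}

lemma measureReal_le_div_of_integral_le {Z : Ω → ℝ} (h0 : ∀ ω, 0 ≤ Z ω) (hint : Integrable Z P)
    {a b : ℝ} (ha : 0 < a) (hb : ∫ ω, Z ω ∂P ≤ b) : P.real {ω | a ≤ Z ω} ≤ b / a := by
  rw [le_div_iff₀' ha]
  exact (mul_meas_ge_le_integral_of_nonneg (ae_of_all _ h0) hint a).trans hb

lemma memLp_comp_hasLaw {F : Type*} [NormedAddCommGroup F] {Z : Ω → α} (hZ : HasLaw Z μ P)
    {f : α → F} {q : ENNReal} (hf : MemLp f q μ) : MemLp (fun ω => f (Z ω)) q P := by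
  rw [← hZ.map_eq] at hf
  exact hf.comp_of_map hZ.aemeasurable

lemma integrable_comp_hasLaw {F : Type*} [NormedAddCommGroup F] {Z : Ω → α} (hZ : HasLaw Z μ P)
    {f : α → F} (hf : Integrable f μ) : Integrable (fun ω => f (Z ω)) P :=
  memLp_one_iff_integrable.1 (memLp_comp_hasLaw hZ (memLp_one_iff_integrable.2 hf))

lemma integral_comp_hasLaw {F : Type*} [NormedAddCommGroup F] [NormedSpace ℝ F] {Z : Ω → α}
    (hZ : HasLaw Z μ P) {f : α → F} (hf : AEStronglyMeasurable f μ) :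
    ∫ ω, f (Z ω) ∂P = ∫ x, f x ∂μ :=
  hZ.integral_comp hf

variable [Fintype ι] {Z : ι → Ω → α}

lemma integral_sum_comp (hlaw : ∀ q, HasLaw (Z q) μ P) {F : Type*} [NormedAddCommGroup F]
    [NormedSpace ℝ F] {f : α → F} (hf : Integrable f μ) :
    ∫ ω, ∑ q, f (Z q ω) ∂P = (Fintype.card ι : ℝ) • ∫ x, f x ∂μ := by
  rw [integral_finsetSum _ fun q _ => integrable_comp_hasLaw (hlaw q) hf]
  simp [integral_comp_hasLaw (hlaw _) hf.aestronglyMeasurable, Nat.cast_smul_eq_nsmul]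

lemma integrable_sum_comp (hlaw : ∀ q, HasLaw (Z q) μ P) {F : Type*} [NormedAddCommGroup F]
    {f : α → F} (hf : Integrable f μ) : Integrable (fun ω => ∑ q, f (Z q ω)) P :=
  integrable_finsetSum _ fun q _ => integrable_comp_hasLaw (hlaw q) hf

lemma variance_sum_comp [IsProbabilityMeasure P] [IsProbabilityMeasure μ] (hlaw : ∀ q, HasLaw (Z q) μ P)
    (hind : iIndepFun Z P) {f : α → ℝ} (hfm : Measurable f) (hf : MemLp f 2 μ) :
    variance (fun ω => ∑ q, f (Z q ω)) P ≤ Fintype.card ι * ∫ x, f x ^ 2 ∂μ := by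
  have h1 : (fun ω => ∑ q, f (Z q ω)) = ∑ q, fun ω => f (Z q ω) := by
    ext ω; simp
  rw [h1, IndepFun.variance_sum (fun q _ => memLp_comp_hasLaw (hlaw q) hf)
    (fun q _ q' _ hqq => (hind.indepFun hqq).comp hfm hfm), ← nsmul_eq_mul, ← Finset.card_univ]
  refine Finset.sum_le_card_nsmul _ _ _ fun q _ => ?_
  refine (variance_le_expectation_sq (memLp_comp_hasLaw (hlaw q) hf).aestronglyMeasurable).trans ?_
  exact (integral_comp_hasLaw (hlaw q) hf.integrable_sq.aestronglyMeasurable).le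

/-- The weak law of large numbers with Chebyshev's bound. -/
lemma measureReal_sum_comp_sub_le [IsProbabilityMeasure P] [IsProbabilityMeasure μ] (hlaw : ∀ q, HasLaw (Z q) μ P)
    (hind : iIndepFun Z P) {f : α → ℝ} (hfm : Measurable f) (hf : MemLp f 2 μ) {a : ℝ}
    (ha : 0 < a) :
    P.real {ω | a ≤ |∑ q, f (Z q ω) - Fintype.card ι * ∫ x, f x ∂μ|} ≤
      (Fintype.card ι * ∫ x, f x ^ 2 ∂μ) / a ^ 2 := by
  have hm : MemLp (fun ω => ∑ q, f (Z q ω)) 2 P :=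
    memLp_finsetSum _ fun q _ => memLp_comp_hasLaw (hlaw q) hf
  have h1 := meas_ge_le_variance_div_sq hm ha
  rw [integral_sum_comp hlaw (hf.integrable one_le_two), smul_eq_mul] at h1
  refine (ENNReal.toReal_mono ENNReal.ofReal_ne_top h1).trans ?_
  rw [ENNReal.toReal_ofReal (div_nonneg (variance_nonneg _ _) (sq_nonneg a))]
  exact div_le_div_of_nonneg_right (variance_sum_comp hlaw hind hfm hf) (sq_nonneg a)

lemma integrable_norm_sq_sum_comp {r : ℕ} (hlaw : ∀ q, HasLaw (Z q) μ P)
    {h : α → EuclideanSpace ℝ (Fin r)} (hh : MemLp h 2 μ) :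
    Integrable (fun ω => ‖∑ q, h (Z q ω)‖ ^ 2) P :=
  have hS : MemLp (fun ω => ∑ q, h (Z q ω)) 2 P :=
    memLp_finsetSum Finset.univ fun q _ => memLp_comp_hasLaw (hlaw q) hh
  (memLp_two_iff_integrable_sq_norm hS.aestronglyMeasurable).1 hS

/-- Coordinatewise, the second moment of the sum is its variance plus its squared mean. The mean is
kept because `g (·, θ_n)` need not be centred. -/
lemma integral_norm_sq_sum_comp_le {r : ℕ} [IsProbabilityMeasure P]
    [IsProbabilityMeasure μ]     (hlaw : ∀ q, HasLaw (Z q) μ P) (hind : iIndepFun Z P)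
    {h : α → EuclideanSpace ℝ (Fin r)} (hhm : Measurable h) (hh : MemLp h 2 μ) :
    ∫ ω, ‖∑ q, h (Z q ω)‖ ^ 2 ∂P ≤
      Fintype.card ι * ∫ x, ‖h x‖ ^ 2 ∂μ + (Fintype.card ι * ‖∫ x, h x ∂μ‖) ^ 2 := by
  have hcm : ∀ a, Measurable fun x => h x a := fun a => by fun_prop
  have hc : ∀ a, MemLp (fun x => h x a) 2 μ := fun a => hh.mono (hcm a).aestronglyMeasurable
    (ae_of_all _ fun x => PiLp.norm_apply_le (h x) a)
  have hcoord : ∀ a, ∫ x, h x a ∂μ = (∫ x, h x ∂μ) a := fun a =>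
    (EuclideanSpace.proj (𝕜 := ℝ) a).integral_comp_comm (hh.integrable one_le_two)
  have hS : ∀ a, MemLp (fun ω => ∑ q, h (Z q ω) a) 2 P := fun a =>
    memLp_finsetSum _ fun q _ => memLp_comp_hasLaw (hlaw q) (hc a)
  have h1 : ∀ a, ∫ ω, (∑ q, h (Z q ω) a) ^ 2 ∂P ≤
      Fintype.card ι * ∫ x, h x a ^ 2 ∂μ + (Fintype.card ι * (∫ x, h x ∂μ) a) ^ 2 := by
    intro a
    have h2 := variance_sum_comp hlaw hind (hcm a) (hc a)
    rw [variance_eq_sub (hS a), integral_sum_comp hlaw ((hc a).integrable one_le_two),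
      smul_eq_mul, hcoord] at h2
    simp only [Pi.pow_apply] at h2
    linarith
  simp only [EuclideanSpace.real_norm_sq_eq, mul_pow, WithLp.ofLp_sum, Finset.sum_apply]
  rw [integral_finsetSum _ fun a _ => (hS a).integrable_sq,
    integral_finsetSum _ fun a _ => (hc a).integrable_sq, Finset.mul_sum, Finset.mul_sum,
    ← Finset.sum_add_distrib]
  refine Finset.sum_le_sum fun a _ => (h1 a).trans_eq ?_
  rw [mul_pow]

end IIDSums

/-! ### Lower bounds for empirical second moments -/

section Spread

variable {α : Type*} [MeasurableSpace α] {μ : Measure α} {r : ℕ}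

/-- A positive definite second moment matrix yields a truncation level at which the truncated
second moments are still positive definite. -/
lemma exists_truncation {h : α → EuclideanSpace ℝ (Fin r)} (hm : Measurable h)
    (hint : ∀ a b, Integrable (fun x => h x a * h x b) μ)
    (hpos : (Matrix.of fun a b => ∫ x, h x a * h x b ∂μ : Matrix (Fin r) (Fin r) ℝ).PosDef) :
    ∃ c > 0, ∃ T > 0, ∀ u : EuclideanSpace ℝ (Fin r), c * ‖u‖ ^ 2 ≤
      ∑ a, ∑ b, u a * u b * ∫ x, {x | ‖h x‖ ≤ T}.indicator (fun x => h x a * h x b) x ∂μ := by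
  set M : Fin r → Fin r → ℝ := fun a b => ∫ x, h x a * h x b ∂μ with hM
  obtain ⟨c, hc, hcM⟩ := exists_pos_mul_norm_pow_le (k := 2)
    (f := fun u : EuclideanSpace ℝ (Fin r) => ∑ a, ∑ b, u a * u b * M a b)
    (by fun_prop)
    (fun t x _ => by
      simp only [Finset.mul_sum, PiLp.smul_apply, smul_eq_mul]
      exact Finset.sum_congr rfl fun a _ => Finset.sum_congr rfl fun b _ => by ring)
    (fun x hx => by
      have := hpos.dotProduct_mulVec_pos (x := x.ofLp) (by simpa using hx)
      refine this.trans_eq ?_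
      simp only [dotProduct, Matrix.mulVec, Finset.mul_sum, Matrix.of_apply, star_trivial]
      exact Finset.sum_congr rfl fun a _ => Finset.sum_congr rfl fun b _ => by ring)
    (by simp) two_ne_zero
  have hlim : ∀ a b, Tendsto (fun T : ℝ => ∫ x, {x | ‖h x‖ ≤ T}.indicator
      (fun x => h x a * h x b) x ∂μ) atTop (𝓝 (M a b)) := by
    intro a b
    refine tendsto_integral_filter_of_dominated_convergence (fun x => ‖h x a * h x b‖) ?_ ?_
      (hint a b).norm ?_
    · refine Eventually.of_forall fun T => ?_
      exact (hint a b).aestronglyMeasurable.indicator (measurableSet_le hm.norm measurable_const)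
    · exact Eventually.of_forall fun T => ae_of_all _ fun x => norm_indicator_le_norm_self _ _
    · refine ae_of_all _ fun x => tendsto_const_nhds.congr' ?_
      filter_upwards [eventually_ge_atTop ‖h x‖] with T hT
      rw [Set.indicator_of_mem (show x ∈ {x | ‖h x‖ ≤ T} from hT)]
  -- Errors of `ε` in each of the `r ^ 2` entries change the quadratic form by at most `c / 2 * ‖u‖
  -- ^ 2`; the `+ 1` covers `r = 0`.
  set ε : ℝ := c / (2 * (r ^ 2 + 1)) with hε
  have hε0 : 0 < ε := by positivity
  have hev : ∀ᶠ T : ℝ in atTop, ∀ a b, |(∫ x, {x | ‖h x‖ ≤ T}.indicator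
      (fun x => h x a * h x b) x ∂μ) - M a b| ≤ ε := by
    refine eventually_all.2 fun a => eventually_all.2 fun b => ?_
    have := (Metric.tendsto_nhds.1 (hlim a b)) ε hε0
    filter_upwards [this] with T hT
    rw [Real.dist_eq] at hT
    exact hT.le
  obtain ⟨T, hT, hT0⟩ := (hev.and (eventually_gt_atTop 0)).exists
  refine ⟨c / 2, by positivity, T, hT0, fun u => ?_⟩
  have h1 : ∑ a, ∑ b, (u a * u b * M a b - ‖u‖ ^ 2 * ε) ≤ ∑ a, ∑ b, u a * u b *
      ∫ x, {x | ‖h x‖ ≤ T}.indicator (fun x => h x a * h x b) x ∂μ := by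
    refine Finset.sum_le_sum fun a _ => Finset.sum_le_sum fun b _ => ?_
    have h2 : |u a * u b * ((∫ x, {x | ‖h x‖ ≤ T}.indicator
        (fun x => h x a * h x b) x ∂μ) - M a b)| ≤ ‖u‖ ^ 2 * ε := by
      rw [abs_mul, abs_mul, sq]
      exact mul_le_mul (mul_le_mul (PiLp.norm_apply_le u a) (PiLp.norm_apply_le u b)
        (abs_nonneg _) (norm_nonneg _)) (hT a b) (abs_nonneg _) (by positivity)
    have := (abs_le.1 h2).1
    linarith
  refine le_trans ?_ h1
  simp only [Finset.sum_sub_distrib, Finset.sum_const, Finset.card_univ, Fintype.card_fin,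
    nsmul_eq_mul]
  have h3 : (r : ℝ) * (r * (‖u‖ ^ 2 * ε)) ≤ c / 2 * ‖u‖ ^ 2 := by
    have h4 : (r : ℝ) ^ 2 * ε ≤ c / 2 := by
      rw [hε, ← mul_div_assoc, div_le_div_iff₀ (by positivity) two_pos]
      nlinarith
    have := mul_le_mul_of_nonneg_right h4 (sq_nonneg ‖u‖)
    linarith
  linarith [hcM u]

/-- A lower bound for the empirical second moments from the truncated ones. -/
lemma le_sum_inner_sq {ι : Type*} [Fintype ι] {m : Fin r → Fin r → ℝ} {c T ε N : ℝ}
    (hm : ∀ u : EuclideanSpace ℝ (Fin r), c * ‖u‖ ^ 2 ≤ ∑ a, ∑ b, u a * u b * m a b)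
    {x : ι → EuclideanSpace ℝ (Fin r)}
    (hx : ∀ a b, |∑ q, {z : EuclideanSpace ℝ (Fin r) | ‖z‖ ≤ T}.indicator
      (fun z => z a * z b) (x q) - N * m a b| ≤ ε * N)
    (hN : 0 ≤ N) (hε : r ^ 2 * ε ≤ c / 2) (u : EuclideanSpace ℝ (Fin r)) :
    c / 2 * N * ‖u‖ ^ 2 ≤ ∑ q, ⟪u, x q⟫ ^ 2 := by
  have h1 : ∑ a, ∑ b, u a * u b * ∑ q, {z : EuclideanSpace ℝ (Fin r) | ‖z‖ ≤ T}.indicator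
      (fun z => z a * z b) (x q) ≤ ∑ q, ⟪u, x q⟫ ^ 2 := by
    simp only [Finset.mul_sum]
    rw [Finset.sum_congr rfl fun a _ => Finset.sum_comm, Finset.sum_comm]
    refine Finset.sum_le_sum fun q _ => ?_
    -- Within the truncation the terms agree; outside it the left one is zero and the right one a
    -- square.
    by_cases hq : ‖x q‖ ≤ T
    · have hq' : x q ∈ {z : EuclideanSpace ℝ (Fin r) | ‖z‖ ≤ T} := hq
      simp only [Set.indicator_of_mem hq']
      rw [PiLp.inner_apply, sq, Finset.sum_mul_sum]
      refine le_of_eq (Finset.sum_congr rfl fun a _ => Finset.sum_congr rfl fun b _ => ?_)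
      simp only [RCLike.inner_apply, conj_trivial]
      ring
    · have hq' : x q ∉ {z : EuclideanSpace ℝ (Fin r) | ‖z‖ ≤ T} := hq
      simp only [Set.indicator_of_notMem hq', mul_zero, Finset.sum_const_zero]
      positivity
  have h2 : ∑ a, ∑ b, (N * (u a * u b * m a b) - ‖u‖ ^ 2 * (ε * N)) ≤ ∑ a, ∑ b, u a * u b *
      ∑ q, {z : EuclideanSpace ℝ (Fin r) | ‖z‖ ≤ T}.indicator (fun z => z a * z b) (x q) := by
    refine Finset.sum_le_sum fun a _ => Finset.sum_le_sum fun b _ => ?_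
    have h2 : |u a * u b * (∑ q, {z : EuclideanSpace ℝ (Fin r) | ‖z‖ ≤ T}.indicator
        (fun z => z a * z b) (x q) - N * m a b)| ≤ ‖u‖ ^ 2 * (ε * N) := by
      rw [abs_mul, abs_mul, sq]
      exact mul_le_mul (mul_le_mul (PiLp.norm_apply_le u a) (PiLp.norm_apply_le u b)
        (abs_nonneg _) (norm_nonneg _)) (hx a b) (abs_nonneg _) (by positivity)
    have := (abs_le.1 h2).1
    linarith
  refine le_trans ?_ (h2.trans h1)
  simp only [Finset.sum_sub_distrib, Finset.sum_const, Finset.card_univ, Fintype.card_fin,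
    nsmul_eq_mul, ← Finset.mul_sum]
  have h3 := mul_le_mul_of_nonneg_left (hm u) hN
  have h4 := mul_le_mul_of_nonneg_right hε (mul_nonneg hN (sq_nonneg ‖u‖))
  nlinarith

/-- Stability of the empirical second moments under perturbations. -/
lemma le_sum_inner_sq_of_perturbation {ι : Type*} [Fintype ι] {a : ℝ}
    {x z : ι → EuclideanSpace ℝ (Fin r)} {u : EuclideanSpace ℝ (Fin r)}
    (hx : a * ‖u‖ ^ 2 ≤ ∑ q, ⟪u, x q⟫ ^ 2) (hz : ∑ q, ‖z q - x q‖ ^ 2 ≤ a / 4) :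
    a / 4 * ‖u‖ ^ 2 ≤ ∑ q, ⟪u, z q⟫ ^ 2 := by
  have h1 : ∑ q, ⟪u, x q⟫ ^ 2 ≤ 2 * ∑ q, ⟪u, z q⟫ ^ 2 + 2 * (‖u‖ ^ 2 * ∑ q, ‖z q - x q‖ ^ 2) := by
    rw [Finset.mul_sum, Finset.mul_sum, Finset.mul_sum, ← Finset.sum_add_distrib]
    refine Finset.sum_le_sum fun q _ => ?_
    have h2 : ⟪u, z q - x q⟫ ^ 2 ≤ ‖u‖ ^ 2 * ‖z q - x q‖ ^ 2 := by
      rw [← mul_pow]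
      exact sq_le_sq.2 ((abs_real_inner_le_norm _ _).trans (le_abs_self _))
    rw [inner_sub_right] at h2
    nlinarith [sq_nonneg (2 * ⟪u, z q⟫ - ⟪u, x q⟫)]
  have h3 := mul_le_mul_of_nonneg_left hz (sq_nonneg ‖u‖)
  linarith

end Spread

/-! ### Probability bounds for the array of observations -/

section Array

variable {Ω α : Type*} [MeasurableSpace Ω] [MeasurableSpace α] {P : Measure Ω}
  {μ : Measure α} {r : ℕ} {X : ℕ → ℕ → Ω → α}

lemma iIndepFun_block (hindep : iIndepFun (fun ij : ℕ × ℕ => X ij.1 ij.2) P) (k n : ℕ) :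
    iIndepFun (fun (q : Fin k × Fin n) => X q.1 q.2) P :=
  hindep.precomp (g := fun q : Fin k × Fin n => ((q.1 : ℕ), (q.2 : ℕ)))
    (Fin.val_injective.prodMap Fin.val_injective)

lemma iIndepFun_row (hindep : iIndepFun (fun ij : ℕ × ℕ => X ij.1 ij.2) P) (i n : ℕ) :
    iIndepFun (fun (j : Fin n) => X i j) P :=
  hindep.precomp (g := fun j : Fin n => (i, (j : ℕ))) fun j j' h => by
    simpa [Fin.ext_iff] using h

/-- Markov's inequality for a double sum of identically distributed variables. -/
lemma measureReal_le_sum_sum_comp (hlaw : ∀ i j, HasLaw (X i j) μ P) {f : α → ℝ} (h0 : ∀ x, 0 ≤ f x)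
    (hf : Integrable f μ) (k n : ℕ) {a : ℝ} (ha : 0 < a) :
    P.real {ω | a ≤ ∑ i : Fin k, ∑ j : Fin n, f (X i j ω)} ≤ (k * n) * (∫ x, f x ∂μ) / a := by
  have hl : ∀ q : Fin k × Fin n, HasLaw (X q.1 q.2) μ P := fun q => hlaw _ _
  simp only [← Fintype.sum_prod_type' (f := fun (i : Fin k) (j : Fin n) => f (X i j _))]
  refine measureReal_le_div_of_integral_le
    (Z := fun ω => ∑ q : Fin k × Fin n, f (X q.1 q.2 ω))
    (fun ω => Finset.sum_nonneg fun q _ => h0 _) (integrable_sum_comp hl hf) ha ?_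
  rw [integral_sum_comp hl hf]
  simp

lemma measureReal_exists_lt_norm_le (hlaw : ∀ i j, HasLaw (X i j) μ P)
    {h : α → EuclideanSpace ℝ (Fin r)} (hm : Measurable h) (k n : ℕ) (a : ℝ) :
    P.real {ω | ∃ (i : Fin k) (j : Fin n), a < ‖h (X i j ω)‖} ≤
      (k * n) * μ.real {x | a < ‖h x‖} := by
  have hset : {ω | ∃ (i : Fin k) (j : Fin n), a < ‖h (X i j ω)‖} =
      ⋃ q : Fin k × Fin n, {ω | a < ‖h (X q.1 q.2 ω)‖} := by
    ext ω; simp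
  rw [hset]
  refine (measureReal_iUnion_fintype_le _).trans_eq ?_
  have : ∀ q : Fin k × Fin n, P.real {ω | a < ‖h (X q.1 q.2 ω)‖} = μ.real {x | a < ‖h x‖} :=
    fun q => (hlaw q.1 q.2).measureReal_eq (p := fun x => a < ‖h x‖)
      (measurableSet_lt measurable_const hm.norm)
  simp [this]

/-- The maximum of `N` variables with a finite second moment is of smaller order than `√N`. -/
lemma tendsto_mul_measureReal_lt_norm [IsProbabilityMeasure μ] {h : α → EuclideanSpace ℝ (Fin r)} (hm : Measurable h)
    (hL : MemLp h 2 μ) {N : ℕ → ℝ} (hN : Tendsto N atTop atTop) {a : ℝ} (ha : 0 < a) :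
    Tendsto (fun n => N n * μ.real {x | a * √(N n) < ‖h x‖}) atTop (𝓝 0) := by
  have hint : Integrable (fun x => ‖h x‖ ^ 2) μ :=
    (memLp_two_iff_integrable_sq_norm hL.aestronglyMeasurable).1 hL
  have hms : ∀ b : ℝ, MeasurableSet {x | b < ‖h x‖} := fun b =>
    measurableSet_lt measurable_const hm.norm
  -- Chebyshev restricted to the tail: `N` times the tail probability is at most `a⁻²` times the
  -- second moment carried by the tail, which vanishes by dominated convergence.
  have hlim : Tendsto (fun n => ∫ x, {x | a * √(N n) < ‖h x‖}.indicator
      (fun x => ‖h x‖ ^ 2) x ∂μ) atTop (𝓝 (∫ _, (0 : ℝ) ∂μ)) := by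
    refine tendsto_integral_of_dominated_convergence (fun x => ‖h x‖ ^ 2)
      (fun n => hint.aestronglyMeasurable.indicator (hms _)) hint
      (fun n => ae_of_all _ fun x => ?_) (ae_of_all _ fun x => tendsto_const_nhds.congr' ?_)
    · refine (norm_indicator_le_norm_self _ _).trans_eq ?_
      simp
    · have : Tendsto (fun n => a * √(N n)) atTop atTop :=
        (Real.tendsto_sqrt_atTop.comp hN).const_mul_atTop ha
      filter_upwards [this.eventually_ge_atTop ‖h x‖] with n hn
      rw [Set.indicator_of_notMem (show x ∉ {x | a * √(N n) < ‖h x‖} from not_lt.2 hn)]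
  rw [integral_zero] at hlim
  have hlim' := hlim.div_const (a ^ 2)
  rw [zero_div] at hlim'
  refine squeeze_zero' ?_ ?_ hlim'
  · filter_upwards [hN.eventually_ge_atTop 0] with n hn
    positivity
  · filter_upwards [hN.eventually_ge_atTop 0] with n hn
    rw [le_div_iff₀' (by positivity), ← mul_assoc]
    refine le_trans ?_ (mul_meas_ge_le_integral_of_nonneg
      (ae_of_all _ fun x => Set.indicator_nonneg (fun x _ => sq_nonneg ‖h x‖) x)
      (hint.indicator (hms _)) (a ^ 2 * N n))
    refine mul_le_mul_of_nonneg_left (measureReal_mono fun x hx => ?_) (by positivity)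
    rw [Set.mem_ofPred_eq, Set.indicator_of_mem hx]
    have h1 : (a * √(N n)) ^ 2 = a ^ 2 * N n := by rw [mul_pow, Real.sq_sqrt hn]
    rw [← h1]
    exact pow_le_pow_left₀ (by positivity) (le_of_lt hx) 2

variable [IsProbabilityMeasure P] [IsProbabilityMeasure μ]

lemma measureReal_le_norm_sq_sum (hlaw : ∀ i j, HasLaw (X i j) μ P)
    (hindep : iIndepFun (fun ij : ℕ × ℕ => X ij.1 ij.2) P)
    {h : α → EuclideanSpace ℝ (Fin r)} (hm : Measurable h) (hL : MemLp h 2 μ) (k n : ℕ)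
    {a : ℝ} (ha : 0 < a) :
    P.real {ω | a ≤ ‖∑ i : Fin k, ∑ j : Fin n, h (X i j ω)‖ ^ 2} ≤
      (k * n * ∫ x, ‖h x‖ ^ 2 ∂μ + (k * n * ‖∫ x, h x ∂μ‖) ^ 2) / a := by
  have hl : ∀ q : Fin k × Fin n, HasLaw (X q.1 q.2) μ P := fun q => hlaw _ _
  simp only [← Fintype.sum_prod_type' (f := fun (i : Fin k) (j : Fin n) => h (X i j _))]
  refine measureReal_le_div_of_integral_le
    (Z := fun ω => ‖∑ q : Fin k × Fin n, h (X q.1 q.2 ω)‖ ^ 2)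
    (fun ω => sq_nonneg _) (integrable_norm_sq_sum_comp hl hL) ha ?_
  refine (integral_norm_sq_sum_comp_le hl (iIndepFun_block hindep k n) hm hL).trans_eq ?_
  simp

lemma measureReal_le_sum_norm_sq_sum (hlaw : ∀ i j, HasLaw (X i j) μ P)
    (hindep : iIndepFun (fun ij : ℕ × ℕ => X ij.1 ij.2) P)
    {h : α → EuclideanSpace ℝ (Fin r)} (hm : Measurable h) (hL : MemLp h 2 μ) (k n : ℕ)
    {a : ℝ} (ha : 0 < a) :
    P.real {ω | a ≤ ∑ i : Fin k, ‖∑ j : Fin n, h (X i j ω)‖ ^ 2} ≤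
      (k * (n * ∫ x, ‖h x‖ ^ 2 ∂μ + (n * ‖∫ x, h x ∂μ‖) ^ 2)) / a := by
  have hl : ∀ i (j : Fin n), HasLaw (X i j) μ P := fun i j => hlaw _ _
  refine measureReal_le_div_of_integral_le
    (Z := fun ω => ∑ i : Fin k, ‖∑ j : Fin n, h (X i j ω)‖ ^ 2)
    (fun ω => Finset.sum_nonneg fun i _ => sq_nonneg _)
    (integrable_finsetSum _ fun i _ => integrable_norm_sq_sum_comp (hl i) hL) ha ?_
  rw [integral_finsetSum _ fun (i : Fin k) _ => integrable_norm_sq_sum_comp (hl i) hL]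
  refine (Finset.sum_le_sum fun (i : Fin k) _ =>
    integral_norm_sq_sum_comp_le (hl i) (iIndepFun_row hindep i n) hm hL).trans_eq ?_
  simp [mul_add]

/-- The truncated second moments obey the law of large numbers. -/
lemma measureReal_truncated_moment_le (hlaw : ∀ i j, HasLaw (X i j) μ P)
    (hindep : iIndepFun (fun ij : ℕ × ℕ => X ij.1 ij.2) P)
    {h : α → EuclideanSpace ℝ (Fin r)} (hm : Measurable h) (k n : ℕ) {T ε : ℝ} (hT : 0 ≤ T)
    (hε : 0 < ε) (hN : 0 < (k : ℝ) * n) (a b : Fin r) :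
    P.real {ω | ε * (k * n) ≤ |∑ q : Fin k × Fin n,
      {z : EuclideanSpace ℝ (Fin r) | ‖z‖ ≤ T}.indicator (fun z => z a * z b) (h (X q.1 q.2 ω)) -
      k * n * ∫ x, {x | ‖h x‖ ≤ T}.indicator (fun x => h x a * h x b) x ∂μ|} ≤
      T ^ 4 / ε ^ 2 / (k * n) := by
  set f : α → ℝ := {x | ‖h x‖ ≤ T}.indicator (fun x => h x a * h x b) with hf
  have hfm : Measurable f :=
    Measurable.indicator (by fun_prop) (measurableSet_le hm.norm measurable_const)
  -- Truncation makes the products bounded, so Chebyshev needs no fourth moment of `h`.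
  have hbd : ∀ x, |f x| ≤ T ^ 2 := by
    intro x
    by_cases hx : ‖h x‖ ≤ T
    · rw [hf, Set.indicator_of_mem (show x ∈ {x | ‖h x‖ ≤ T} from hx), abs_mul, sq]
      exact mul_le_mul ((PiLp.norm_apply_le (h x) a).trans hx)
        ((PiLp.norm_apply_le (h x) b).trans hx) (abs_nonneg _) hT
    · rw [hf, Set.indicator_of_notMem (show x ∉ {x | ‖h x‖ ≤ T} from hx), abs_zero]
      positivity
  have hL : MemLp f 2 μ := MemLp.of_bound hfm.aestronglyMeasurable (T ^ 2) (ae_of_all _ hbd)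
  have h1 := measureReal_sum_comp_sub_le (fun q : Fin k × Fin n => hlaw q.1 q.2)
    (iIndepFun_block hindep k n) hfm hL (mul_pos hε hN)
  simp only [Fintype.card_prod, Fintype.card_fin, Nat.cast_mul] at h1
  refine h1.trans ?_
  have h2 : ∫ x, f x ^ 2 ∂μ ≤ T ^ 4 := by
    have : ∫ x, f x ^ 2 ∂μ ≤ ∫ _, T ^ 4 ∂μ := by
      refine integral_mono hL.integrable_sq (integrable_const _) fun x => ?_
      have := pow_le_pow_left₀ (abs_nonneg _) (hbd x) 2
      rw [sq_abs] at this
      exact this.trans_eq (by ring)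
    simpa using this
  rw [div_div, div_le_div_iff₀ (by positivity) (by positivity)]
  have h3 := mul_le_mul_of_nonneg_left h2 (show 0 ≤ ε ^ 2 * (k * n) ^ 2 by positivity)
  linarith

end Array

/-! ### Regularity of samples with high probability -/

section RegularSamples

variable {Ω α : Type*} {r : ℕ} {X : ℕ → ℕ → Ω → α}

/-- The sample of size `k n` of values of `h`. -/
def sampleValues (X : ℕ → ℕ → Ω → α) (h : α → EuclideanSpace ℝ (Fin r)) (k n : ℕ) (ω : Ω) :
    Fin k → Fin n → EuclideanSpace ℝ (Fin r) :=
  fun i j => h (X i j ω)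

/-- A sample is regular off six exceptional events. -/
lemma regularSample_of_events {h h₀ : α → EuclideanSpace ℝ (Fin r)} {k n : ℕ}
    {c T ε B δ : ℝ} (hN : 0 < (k : ℝ) * n)
    {m : Fin r → Fin r → ℝ}
    (hm : ∀ u : EuclideanSpace ℝ (Fin r), c * ‖u‖ ^ 2 ≤ ∑ a, ∑ b, u a * u b * m a b)
    (hε : r ^ 2 * ε ≤ c / 2) (hδ : 0 < δ) {ω : Ω}
    (h1 : ‖∑ i : Fin k, ∑ j : Fin n, h (X i j ω)‖ ^ 2 < B ^ 2 * (k * n))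
    (h2 : ∑ i : Fin k, ‖∑ j : Fin n, h (X i j ω)‖ ^ 2 < B ^ 2 * (k * n))
    (h3 : ∑ i : Fin k, ∑ j : Fin n, ‖h (X i j ω)‖ ^ 2 < B ^ 2 * (k * n))
    (h4 : ∑ i : Fin k, ∑ j : Fin n, ‖h (X i j ω) - h₀ (X i j ω)‖ ^ 2 <
      min (c / 8) ((δ / 2) ^ 2) * (k * n))
    (h5 : ¬ ∃ (i : Fin k) (j : Fin n), δ / 2 * √(k * n) < ‖h₀ (X i j ω)‖)
    (h6 : ∀ a b, |∑ q : Fin k × Fin n,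
      {z : EuclideanSpace ℝ (Fin r) | ‖z‖ ≤ T}.indicator (fun z => z a * z b) (h₀ (X q.1 q.2 ω)) -
      k * n * m a b| < ε * (k * n)) :
    RegularSample (c / 8) B δ (sampleValues X h k n ω) where
  spread u := by
    -- The spread drops from `c` to `c / 2` by sampling error at `h₀`, and to a quarter of that by
    -- passing to `h`: hence `c / 8`.
    have h7 := le_sum_inner_sq hm (fun a b => (h6 a b).le) hN.le hε u
    have h8 : ∑ q : Fin k × Fin n, ‖h (X q.1 q.2 ω) - h₀ (X q.1 q.2 ω)‖ ^ 2 ≤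
        c / 2 * (k * n) / 4 := by
      rw [Fintype.sum_prod_type]
      have := mul_le_mul_of_nonneg_right (min_le_left (c / 8) ((δ / 2) ^ 2)) hN.le
      linarith
    have h9 := le_sum_inner_sq_of_perturbation h7 h8
    rw [Fintype.sum_prod_type] at h9
    simp only [sampleValues]
    linarith
  norm_sum := h1.le
  sum_sq_norm := h2.le
  sum_sq := h3.le
  norm_le i j := by
    push Not at h5
    -- A single deviation is bounded by the whole sum in `h4`, so only the tail of `h₀` has to be
    -- controlled, not that of `h`.
    have h7 : ‖h (X i j ω) - h₀ (X i j ω)‖ ^ 2 ≤ (δ / 2 * √(k * n)) ^ 2 := by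
      rw [mul_pow, Real.sq_sqrt hN.le]
      have h8 := Finset.single_le_sum (f := fun j : Fin n => ‖h (X i j ω) - h₀ (X i j ω)‖ ^ 2)
        (fun j _ => sq_nonneg _) (Finset.mem_univ j)
      have h9 := Finset.single_le_sum
        (f := fun i : Fin k => ∑ j : Fin n, ‖h (X i j ω) - h₀ (X i j ω)‖ ^ 2)
        (fun i _ => Finset.sum_nonneg fun j _ => sq_nonneg _) (Finset.mem_univ i)
      have h10 := mul_le_mul_of_nonneg_right (min_le_right (c / 8) ((δ / 2) ^ 2)) hN.le
      linarith
    have h8 := (abs_le_of_sq_le_sq' h7 (by positivity)).2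
    have h9 := norm_add_le (h (X i j ω) - h₀ (X i j ω)) (h₀ (X i j ω))
    rw [sub_add_cancel] at h9
    simp only [sampleValues]
    linarith [h5 i j]

variable [MeasurableSpace Ω] [MeasurableSpace α] {P : Measure Ω} {μ : Measure α}

lemma memLp_two_of_integrable_mul {h : α → EuclideanSpace ℝ (Fin r)} (hm : Measurable h)
    (hint : ∀ a b, Integrable (fun x => h x a * h x b) μ) : MemLp h 2 μ := by
  rw [memLp_two_iff_integrable_sq_norm hm.aestronglyMeasurable]
  simp only [EuclideanSpace.real_norm_sq_eq]
  exact integrable_finsetSum _ fun a _ => by simpa only [sq] using hint a a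

/-- Second moments of a perturbation. -/
lemma integral_norm_sq_le {h h₀ : α → EuclideanSpace ℝ (Fin r)} (hL : MemLp h 2 μ)
    (hL₀ : MemLp h₀ 2 μ) :
    ∫ x, ‖h x‖ ^ 2 ∂μ ≤ 2 * ∫ x, ‖h₀ x‖ ^ 2 ∂μ + 2 * ∫ x, ‖h x - h₀ x‖ ^ 2 ∂μ := by
  have hi : ∀ {f : α → EuclideanSpace ℝ (Fin r)}, MemLp f 2 μ →
      Integrable (fun x => ‖f x‖ ^ 2) μ := fun hf =>
    (memLp_two_iff_integrable_sq_norm hf.aestronglyMeasurable).1 hf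
  have h1 : Integrable (fun x => ‖h x - h₀ x‖ ^ 2) μ := hi (hL.sub hL₀)
  rw [← integral_const_mul, ← integral_const_mul,
    ← integral_add ((hi hL₀).const_mul 2) (h1.const_mul 2)]
  refine integral_mono (hi hL) (((hi hL₀).const_mul 2).add (h1.const_mul 2)) fun x => ?_
  have h2 := norm_add_le (h₀ x) (h x - h₀ x)
  rw [add_sub_cancel] at h2
  have h3 := pow_le_pow_left₀ (norm_nonneg _) h2 2
  simp only
  nlinarith [sq_nonneg (‖h₀ x‖ - ‖h x - h₀ x‖)]

/-- Samples of a triangular array which converges in mean square and whose means are of the order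
`N ^ (-1 / 2)` are regular with high probability. -/
theorem exists_regularSample [IsProbabilityMeasure P] [IsProbabilityMeasure μ]
    (hlaw : ∀ i j, HasLaw (X i j) μ P)
    (hindep : iIndepFun (fun ij : ℕ × ℕ => X ij.1 ij.2) P)
    {K : ℕ → ℕ} (hK : ∀ n, 1 ≤ K n) {h : ℕ → α → EuclideanSpace ℝ (Fin r)}
    {h₀ : α → EuclideanSpace ℝ (Fin r)} (hm : ∀ n, Measurable (h n)) (hm₀ : Measurable h₀)
    (hint : ∀ a b, Integrable (fun x => h₀ x a * h₀ x b) μ)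
    (hpos : (Matrix.of fun a b => ∫ x, h₀ x a * h₀ x b ∂μ : Matrix (Fin r) (Fin r) ℝ).PosDef)
    (hL : ∀ᶠ n in atTop, MemLp (h n) 2 μ)
    (hdiff : Tendsto (fun n => ∫ x, ‖h n x - h₀ x‖ ^ 2 ∂μ) atTop (𝓝 0))
    {C : ℝ} (hmean : ∀ᶠ n in atTop, ((K n : ℝ) * n) * ‖∫ x, h n x ∂μ‖ ^ 2 ≤ C) :
    ∃ c > 0, ∀ ε > 0, ∃ B ≥ 0, ∀ δ > 0, ∀ᶠ n in atTop,
      P.real {ω | ¬ RegularSample c B δ (sampleValues X (h n) (K n) n ω)} ≤ ε := by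
  obtain ⟨c, hc, T, hT, hcT⟩ := exists_truncation hm₀ hint hpos
  have hL₀ := memLp_two_of_integrable_mul hm₀ hint
  refine ⟨c / 8, by positivity, fun ε hε => ?_⟩
  set V : ℝ := 2 * ∫ x, ‖h₀ x‖ ^ 2 ∂μ + 2 with hVdef
  have hV : 0 ≤ V := by positivity
  set W : ℝ := V + |C| with hW
  have hW0 : 0 ≤ W := by positivity
  -- Each of the three Markov bounds involving `B` then costs at most `ε / 6`. The other three
  -- exceptional events have vanishing bounds and share the remaining `ε / 2`. Since `B` does not
  -- depend on `δ`, callers can choose `δ` afterwards.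
  set B : ℝ := √(6 * W / ε) + 1 with hB
  have hB1 : 1 ≤ B := by rw [hB]; linarith [Real.sqrt_nonneg (6 * W / ε)]
  have hBW : W / B ^ 2 ≤ ε / 6 := by
    have h1 : 6 * W / ε ≤ B ^ 2 := by
      rw [← Real.sq_sqrt (show 0 ≤ 6 * W / ε by positivity)]
      exact pow_le_pow_left₀ (Real.sqrt_nonneg _) (by rw [hB]; linarith) 2
    rw [div_le_iff₀ hε] at h1
    rw [div_le_div_iff₀ (by positivity) (by norm_num)]
    linarith
  refine ⟨B, by linarith, fun δ hδ => ?_⟩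
  set N : ℕ → ℝ := fun n => (K n : ℝ) * n with hN
  have hNtop : Tendsto N atTop atTop := by
    refine tendsto_atTop_mono (fun n => ?_) tendsto_natCast_atTop_atTop
    exact le_mul_of_one_le_left (Nat.cast_nonneg n) (by exact_mod_cast hK n)
  -- The first bound protects the spread, the second the maximum.
  set κ : ℝ := min (c / 8) ((δ / 2) ^ 2) with hκ
  have hκ0 : 0 < κ := lt_min (by positivity) (by positivity)
  set e : ℝ := c / (2 * (r ^ 2 + 1)) with he
  have he0 : 0 < e := by positivity
  have hre : (r : ℝ) ^ 2 * e ≤ c / 2 := by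
    rw [he, ← mul_div_assoc, div_le_div_iff₀ (by positivity) two_pos]
    nlinarith
  have hsmall : Tendsto (fun n => (∫ x, ‖h n x - h₀ x‖ ^ 2 ∂μ) / κ +
      N n * μ.real {x | δ / 2 * √(N n) < ‖h₀ x‖} +
      ∑ _a : Fin r, ∑ _b : Fin r, T ^ 4 / e ^ 2 / N n) atTop (𝓝 0) := by
    have h1 := hdiff.div_const κ
    have h2 := tendsto_mul_measureReal_lt_norm hm₀ hL₀ hNtop (half_pos hδ)
    have h3 : Tendsto (fun n => ∑ _a : Fin r, ∑ _b : Fin r, T ^ 4 / e ^ 2 / N n) atTop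
        (𝓝 (∑ _a : Fin r, ∑ _b : Fin r, 0)) :=
      tendsto_finsetSum _ fun a _ => tendsto_finsetSum _ fun b _ => hNtop.const_div_atTop _
    simpa using (h1.add h2).add h3
  filter_upwards [hL, hmean, hNtop.eventually_gt_atTop 0, hdiff.eventually_le_const one_pos,
    hsmall.eventually_le_const (half_pos hε)] with n hLn hmn hNn hdn hsn
  have hB2 : 0 < B ^ 2 * N n := by positivity
  have hVn : ∫ x, ‖h n x‖ ^ 2 ∂μ ≤ V := (integral_norm_sq_le hLn hL₀).trans (by linarith)
  have hmn' : N n * ‖∫ x, h n x ∂μ‖ ^ 2 ≤ |C| := hmn.trans (le_abs_self C)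
  have hL' : MemLp (fun x => h n x - h₀ x) 2 μ := hLn.sub hL₀
  have hsq : ∀ {f : α → EuclideanSpace ℝ (Fin r)}, MemLp f 2 μ →
      Integrable (fun x => ‖f x‖ ^ 2) μ := fun hf =>
    (memLp_two_iff_integrable_sq_norm hf.aestronglyMeasurable).1 hf
  have hle : ∀ {x : ℝ}, x ≤ W * N n → x / (B ^ 2 * N n) ≤ ε / 6 := by
    intro x hx
    refine le_trans ?_ hBW
    rw [div_le_div_iff₀ hB2 (by positivity)]
    nlinarith [mul_le_mul_of_nonneg_right hx (sq_nonneg B)]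
  have hVN := mul_le_mul_of_nonneg_right hVn hNn.le
  have hCN := mul_le_mul_of_nonneg_right hmn' hNn.le
  have b1 := (measureReal_le_norm_sq_sum hlaw hindep (hm n) hLn (K n) n hB2).trans
    (hle (by simp only [hW]; nlinarith))
  have b2 := (measureReal_le_sum_norm_sq_sum hlaw hindep (hm n) hLn (K n) n hB2).trans
    (hle (by
      -- The squared means of the `K` node sums add up to `n` times `N ‖∫ h‖²`, at most `n |C|`, and
      -- `n ≤ N`.
      have h1 : (n : ℝ) ≤ N n :=
        le_mul_of_one_le_left (Nat.cast_nonneg n) (by exact_mod_cast hK n)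
      have h2 : (n : ℝ) * (N n * ‖∫ x, h n x ∂μ‖ ^ 2) ≤ N n * (N n * ‖∫ x, h n x ∂μ‖ ^ 2) :=
        mul_le_mul_of_nonneg_right h1 (by positivity)
      have h3 : (K n : ℝ) * (n * ∫ x, ‖h n x‖ ^ 2 ∂μ + (n * ‖∫ x, h n x ∂μ‖) ^ 2) =
          (∫ x, ‖h n x‖ ^ 2 ∂μ) * N n + n * (N n * ‖∫ x, h n x ∂μ‖ ^ 2) := by
        simp only [hN]; ring
      rw [h3, hW]
      linarith))
  have b3 := (measureReal_le_sum_sum_comp hlaw (fun x => sq_nonneg ‖h n x‖) (hsq hLn) (K n) n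
    hB2).trans (hle (by
      have : 0 ≤ |C| * N n := by positivity
      simp only [hW, hN] at *
      linarith))
  have b4 := measureReal_le_sum_sum_comp hlaw (fun x => sq_nonneg ‖h n x - h₀ x‖) (hsq hL')
    (K n) n (mul_pos hκ0 hNn)
  have b5 := measureReal_exists_lt_norm_le hlaw hm₀ (K n) n (δ / 2 * √(N n))
  have b6 := fun a b => measureReal_truncated_moment_le hlaw hindep hm₀ (K n) n hT.le he0 hNn a b
  have b4' : (K n * n) * (∫ x, ‖h n x - h₀ x‖ ^ 2 ∂μ) / (κ * N n) =
      (∫ x, ‖h n x - h₀ x‖ ^ 2 ∂μ) / κ := by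
    rw [mul_comm κ]
    exact mul_div_mul_left _ _ hNn.ne'
  rw [b4'] at b4
  set E₁ := {ω | B ^ 2 * N n ≤ ‖∑ i : Fin (K n), ∑ j : Fin n, h n (X i j ω)‖ ^ 2}
  set E₂ := {ω | B ^ 2 * N n ≤ ∑ i : Fin (K n), ‖∑ j : Fin n, h n (X i j ω)‖ ^ 2}
  set E₃ := {ω | B ^ 2 * N n ≤ ∑ i : Fin (K n), ∑ j : Fin n, ‖h n (X i j ω)‖ ^ 2}
  set E₄ := {ω | κ * N n ≤
    ∑ i : Fin (K n), ∑ j : Fin n, ‖h n (X i j ω) - h₀ (X i j ω)‖ ^ 2}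
  set E₅ := {ω | ∃ (i : Fin (K n)) (j : Fin n), δ / 2 * √(N n) < ‖h₀ (X i j ω)‖}
  set E₆ : Fin r → Fin r → Set Ω := fun a b => {ω | e * (K n * n) ≤
    |∑ q : Fin (K n) × Fin n, {z : EuclideanSpace ℝ (Fin r) | ‖z‖ ≤ T}.indicator
      (fun z => z a * z b) (h₀ (X q.1 q.2 ω)) -
      K n * n * ∫ x, {x | ‖h₀ x‖ ≤ T}.indicator (fun x => h₀ x a * h₀ x b) x ∂μ|} with hE₆
  have hsub : {ω | ¬ RegularSample (c / 8) B δ (sampleValues X (h n) (K n) n ω)} ⊆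
      E₁ ∪ E₂ ∪ E₃ ∪ E₄ ∪ E₅ ∪ ⋃ a, ⋃ b, E₆ a b := by
    intro ω hω
    by_contra hnot
    simp only [Set.mem_union, Set.mem_iUnion, not_or, not_exists] at hnot
    obtain ⟨⟨⟨⟨⟨n1, n2⟩, n3⟩, n4⟩, n5⟩, n6⟩ := hnot
    exact hω (regularSample_of_events hNn hcT hre hδ (not_le.1 n1) (not_le.1 n2) (not_le.1 n3)
      (not_le.1 n4) n5 fun a b => not_le.1 (n6 a b))
  have u6 : P.real (⋃ a, ⋃ b, E₆ a b) ≤ ∑ _a : Fin r, ∑ _b : Fin r, T ^ 4 / e ^ 2 / N n :=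
    (measureReal_iUnion_fintype_le _).trans (Finset.sum_le_sum fun a _ =>
      (measureReal_iUnion_fintype_le _).trans (Finset.sum_le_sum fun b _ => b6 a b))
  have u1 := measureReal_union_le (μ := P) E₁ E₂
  have u2 := measureReal_union_le (μ := P) (E₁ ∪ E₂) E₃
  have u3 := measureReal_union_le (μ := P) (E₁ ∪ E₂ ∪ E₃) E₄
  have u4 := measureReal_union_le (μ := P) (E₁ ∪ E₂ ∪ E₃ ∪ E₄) E₅
  have u5 := measureReal_union_le (μ := P) (E₁ ∪ E₂ ∪ E₃ ∪ E₄ ∪ E₅) (⋃ a, ⋃ b, E₆ a b)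
  have u0 := measureReal_mono (μ := P) hsub
  have b5' : P.real E₅ ≤ N n * μ.real {x | δ / 2 * √(N n) < ‖h₀ x‖} := b5
  linarith

end RegularSamples

/-! ### Passage to probability tending to one -/

section Limits

lemma withProbTendingToOne_of_real {Ω : Type*} [MeasurableSpace Ω] {P : Measure Ω}
    [IsProbabilityMeasure P] {E : ℕ → Ω → Prop}
    (h : ∀ ε > 0, ∀ᶠ n in atTop, P.real {ω | ¬ E n ω} ≤ ε) : WithProbTendingToOne P E := by
  refine (ENNReal.tendsto_toReal_iff (fun n => measure_ne_top _ _) ENNReal.zero_ne_top).1 ?_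
  refine Metric.tendsto_nhds.2 fun ε hε => ?_
  filter_upwards [h (ε / 2) (half_pos hε)] with n hn
  rw [ENNReal.toReal_zero, Real.dist_eq, sub_zero, abs_of_nonneg ENNReal.toReal_nonneg]
  exact lt_of_le_of_lt hn (half_lt_self hε)

lemma WithProbTendingToOne.and {Ω : Type*} [MeasurableSpace Ω] {P : Measure Ω}
    {E F : ℕ → Ω → Prop} (hE : WithProbTendingToOne P E) (hF : WithProbTendingToOne P F) :
    WithProbTendingToOne P fun n ω => E n ω ∧ F n ω := by
  have h := hE.add hF
  rw [add_zero] at h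
  refine tendsto_of_tendsto_of_tendsto_of_le_of_le tendsto_const_nhds h (fun _ => zero_le)
    fun n => (measure_mono fun ω hω => ?_).trans (measure_union_le _ _)
  simpa only [Set.mem_union, Set.mem_ofPred_eq, ← not_and_or] using hω

lemma WithProbTendingToOne.mono {Ω : Type*} [MeasurableSpace Ω] {P : Measure Ω}
    {E F : ℕ → Ω → Prop} (hE : WithProbTendingToOne P E) (h : ∀ n ω, E n ω → F n ω) :
    WithProbTendingToOne P F :=
  tendsto_of_tendsto_of_tendsto_of_le_of_le tendsto_const_nhds hE (fun _ => zero_le)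
    fun n => measure_mono fun ω hω hEω => hω (h n ω hEω)

variable {Ω α : Type*} [MeasurableSpace Ω] [MeasurableSpace α] {P : Measure Ω}
  [IsProbabilityMeasure P] {μ : Measure α} {r : ℕ} {X : ℕ → ℕ → Ω → α} {K : ℕ → ℕ}
  {G : (n : ℕ) → SimpleGraph (Fin (K n))} {η : ℕ → ℝ}

/-- A tuning parameter of larger order than `N ^ 2` forces consensus. -/
theorem withProbTendingToOne_sameSolutions (hlaw : ∀ i j, HasLaw (X i j) μ P)
    (hK : ∀ n, 1 ≤ K n) (hG : ∀ n, (G n).Connected) (hη : ∀ n, 0 < η n)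
    (hlim : Tendsto (fun n : ℕ => η n / ((K n : ℝ) * n) ^ 2) atTop atTop)
    {h : α → EuclideanSpace ℝ (Fin r)} (hint : Integrable h μ) :
    WithProbTendingToOne P fun n ω => SameSolutions (G n) (η n) (sampleValues X h (K n) n ω) := by
  refine withProbTendingToOne_of_real fun ε hε => ?_
  have h0 : Tendsto (fun n : ℕ => 2 * (∫ x, ‖h x‖ ∂μ) * (η n / ((K n : ℝ) * n) ^ 2)⁻¹) atTop
      (𝓝 0) := by
    simpa using hlim.inv_tendsto_atTop.const_mul (2 * ∫ x, ‖h x‖ ∂μ)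
  filter_upwards [h0.eventually_le_const hε, eventually_gt_atTop 0] with n hn hn0
  have hN : 0 < (K n : ℝ) * n := by
    have := hK n
    positivity
  -- The threshold `η / (2 N)` for `∑ ‖y‖` is that of the deterministic criterion; Markov bounds the
  -- failure by `2 N² ∫ ‖h‖ / η`.
  refine le_trans (measureReal_mono fun ω hω => ?_) ((measureReal_le_sum_sum_comp hlaw
    (fun x => norm_nonneg (h x)) hint.norm (K n) n
    (a := η n / (2 * (K n * n))) (div_pos (hη n) (by positivity))).trans ?_)
  · rw [Set.mem_ofPred_eq, div_le_iff₀' (by positivity)]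
    by_contra! hlt
    refine hω (sameSolutions_of_sum_norm_lt (hG n) (hη n) (lt_of_eq_of_lt ?_ hlt))
    simp only [sampleValues]
    ring
  · refine le_trans (le_of_eq ?_) hn
    have := (hη n).ne'
    field_simp

/-- Mean square convergence, expressed by Bochner integrals. -/
lemma tendsto_integral_norm_sq_of_lintegral {h : ℕ → α → EuclideanSpace ℝ (Fin r)}
    {h₀ : α → EuclideanSpace ℝ (Fin r)} (hm : ∀ n, Measurable (h n)) (hm₀ : Measurable h₀)
    (hL₀ : MemLp h₀ 2 μ) (hlim : Tendsto (fun n => ∫⁻ x, ‖h n x - h₀ x‖ₑ ^ 2 ∂μ) atTop (𝓝 0)) :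
    (∀ᶠ n in atTop, MemLp (h n) 2 μ) ∧
      Tendsto (fun n => ∫ x, ‖h n x - h₀ x‖ ^ 2 ∂μ) atTop (𝓝 0) := by
  have heq : ∀ n x, ENNReal.ofReal (‖h n x - h₀ x‖ ^ 2) = ‖h n x - h₀ x‖ₑ ^ 2 := fun n x => by
    rw [ENNReal.ofReal_pow (norm_nonneg _), ofReal_norm]
  have hms : ∀ n, Measurable fun x => ‖h n x - h₀ x‖ ^ 2 := fun n =>
    ((hm n).sub hm₀).norm.pow_const 2
  constructor
  · filter_upwards [hlim.eventually_lt_const ENNReal.zero_lt_top] with n hn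
    have h1 : MemLp (h n - h₀) 2 μ := by
      rw [memLp_two_iff_integrable_sq_norm ((hm n).sub hm₀).aestronglyMeasurable]
      refine ⟨(hms n).aestronglyMeasurable, ?_⟩
      rw [hasFiniteIntegral_iff_ofReal (ae_of_all _ fun x => sq_nonneg _)]
      simpa only [Pi.sub_apply, heq] using hn
    simpa using h1.add hL₀
  · have h1 : ∀ n, ∫ x, ‖h n x - h₀ x‖ ^ 2 ∂μ = (∫⁻ x, ‖h n x - h₀ x‖ₑ ^ 2 ∂μ).toReal := by
      intro n
      rw [integral_eq_lintegral_of_nonneg_ae (ae_of_all _ fun x => sq_nonneg _)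
        (hms n).aestronglyMeasurable]
      simp only [heq]
    simp only [h1]
    simpa [Function.comp_def] using (ENNReal.tendsto_toReal ENNReal.zero_ne_top).comp hlim

variable [IsProbabilityMeasure μ]

/-- With probability tending to one the sample is not contained in a half-space. -/
theorem withProbTendingToOne_noHalfSpace (hlaw : ∀ i j, HasLaw (X i j) μ P)
    (hindep : iIndepFun (fun ij : ℕ × ℕ => X ij.1 ij.2) P) (hK : ∀ n, 1 ≤ K n)
    {h : α → EuclideanSpace ℝ (Fin r)} (hm : Measurable h) (hmean : ∫ x, h x ∂μ = 0)
    (hint : ∀ a b, Integrable (fun x => h x a * h x b) μ)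
    (hpos : (Matrix.of fun a b => ∫ x, h x a * h x b ∂μ : Matrix (Fin r) (Fin r) ℝ).PosDef) :
    WithProbTendingToOne P fun n ω => NoHalfSpace (sampleValues X h (K n) n ω) := by
  obtain ⟨c, hc, H⟩ := exists_regularSample hlaw hindep hK (h := fun _ => h) (fun _ => hm) hm hint
    hpos (Eventually.of_forall fun _ => memLp_two_of_integrable_mul hm hint) (by simp)
    (C := 0) (by simp [hmean])
  refine withProbTendingToOne_of_real fun ε hε => ?_
  obtain ⟨B, hB, H⟩ := H ε hε
  -- The `+ 1` keeps the denominator positive when `B = 0`.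
  have hδ : 0 < c / (4 * (B + 1)) := by positivity
  have hδB : c / (4 * (B + 1)) * B ≤ c / 4 := by
    rw [div_mul_eq_mul_div, div_le_div_iff₀ (by positivity) (by positivity)]
    nlinarith
  filter_upwards [H _ hδ, eventually_gt_atTop 0] with n hn hn0
  have hN : 0 < (K n : ℝ) * n := by
    have := hK n
    positivity
  refine (measureReal_mono ?_).trans hn
  exact fun ω hω hR => hω (hR.noHalfSpace hB hδ.le hc hδB hN)

/-- A tuning parameter of larger order than `K √(n log K)` forces consensus along triangular
arrays. -/
theorem withProbTendingToOne_minimizersCoincide (hlaw : ∀ i j, HasLaw (X i j) μ P)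
    (hindep : iIndepFun (fun ij : ℕ × ℕ => X ij.1 ij.2) P)
    (hK : ∀ n, 1 ≤ K n) (hG : ∀ n, (G n).Connected) (hη : ∀ n, 0 < η n)
    (hlim : (fun n : ℕ => (K n : ℝ) * √(n * Real.log (K n))) =o[atTop] η)
    {h : ℕ → α → EuclideanSpace ℝ (Fin r)}
    {h₀ : α → EuclideanSpace ℝ (Fin r)} (hm : ∀ n, Measurable (h n)) (hm₀ : Measurable h₀)
    (hint : ∀ a b, Integrable (fun x => h₀ x a * h₀ x b) μ)
    (hpos : (Matrix.of fun a b => ∫ x, h₀ x a * h₀ x b ∂μ : Matrix (Fin r) (Fin r) ℝ).PosDef)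
    (hL : ∀ᶠ n in atTop, MemLp (h n) 2 μ)
    (hdiff : Tendsto (fun n => ∫ x, ‖h n x - h₀ x‖ ^ 2 ∂μ) atTop (𝓝 0))
    {C : ℝ} (hmean : ∀ᶠ n in atTop, ((K n : ℝ) * n) * ‖∫ x, h n x ∂μ‖ ^ 2 ≤ C) :
    WithProbTendingToOne P fun n ω =>
      MinimizersCoincide (G n) (η n) (sampleValues X (h n) (K n) n ω) := by
  obtain ⟨c, hc, H⟩ := exists_regularSample hlaw hindep hK hm hm₀ hint hpos hL hdiff hmean
  refine withProbTendingToOne_of_real fun ε hε => ?_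
  obtain ⟨B, hB, H⟩ := H ε hε
  have hδ : 0 < c / (4 * (B + 1)) := by positivity
  have hδB : c / (4 * (B + 1)) * B ≤ c / 4 := by
    rw [div_mul_eq_mul_div, div_le_div_iff₀ (by positivity) (by positivity)]
    nlinarith
  set D : ℝ := B + 4 * B ^ 3 / c with hD
  have hD0 : 0 ≤ D := by positivity
  filter_upwards [H _ hδ, eventually_gt_atTop 0,
    hlim.def (show 0 < 1 / (4 * D + 1) by positivity)] with n hn hn0 hηn
  have hN : 0 < (K n : ℝ) * n := by
    have := hK n
    positivity
  have hηK : 1 < K n → 2 * (D * (K n * √n)) < η n := by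
    intro hK2
    rw [Real.norm_of_nonneg (by positivity), Real.norm_of_nonneg (hη n).le, div_mul_eq_mul_div,
      one_mul, le_div_iff₀ (by positivity)] at hηn
    -- For `K ≥ 2` this gives `√(log K) ≥ 1 / 2`, so a factor `4 D` in front of `K √(n log K)`
    -- yields `2 D K √n`; the extra `1` in `4 D + 1` makes the inequality strict.
    have hlog : (1 / 2) ^ 2 ≤ Real.log (K n) := by
      have h1 : Real.log 2 ≤ Real.log (K n) :=
        Real.log_le_log two_pos (by exact_mod_cast hK2)
      linarith [Real.log_two_gt_d9]
    have hs : √n * (1 / 2) ≤ √(n * Real.log (K n)) := by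
      rw [Real.sqrt_mul (Nat.cast_nonneg n)]
      exact mul_le_mul_of_nonneg_left (Real.le_sqrt_of_sq_le hlog) (Real.sqrt_nonneg _)
    have hKs := mul_le_mul_of_nonneg_left hs (Nat.cast_nonneg (α := ℝ) (K n))
    have h2 := mul_le_mul_of_nonneg_left hKs (show 0 ≤ 4 * D by positivity)
    have h3 : 0 < (K n : ℝ) * √(n * Real.log (K n)) := by
      have : 0 < Real.log (K n) := lt_of_lt_of_le (by norm_num) hlog
      have := hK n
      positivity
    nlinarith
  refine (measureReal_mono ?_).trans hn
  exact fun ω hω hR => hω (hR.minimizersCoincide hB hδ.le hc hδB hN (hG n) (hη n) hηK)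

end Limits

end DecentralizedEL

/-! ### The theorem -/

theorem theorem2p1 {Ω : Type*} [MeasurableSpace Ω] (P : Measure Ω) [IsProbabilityMeasure P]
    {d p r : ℕ}
    -- the observations: i.i.d. with common law `μ`
    (μ : Measure (EuclideanSpace ℝ (Fin d)))
    (X : ℕ → ℕ → Ω → EuclideanSpace ℝ (Fin d))
    (hlaw : ∀ i j, HasLaw (X i j) μ P)
    (hindep : iIndepFun (fun ij : ℕ × ℕ => X ij.1 ij.2) P)
    -- the estimating function and the true parameter
    (g : EuclideanSpace ℝ (Fin d) → EuclideanSpace ℝ (Fin p) → EuclideanSpace ℝ (Fin r))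
    (hgmeas : ∀ θ, Measurable fun x => g x θ)
    (θ₀ : EuclideanSpace ℝ (Fin p))
    (hunbiased : ∫ x, g x θ₀ ∂μ = 0)
    -- the second moment matrix at the true parameter is finite and positive definite
    (hfinite : ∀ a b, Integrable (fun x => g x θ₀ a * g x θ₀ b) μ)
    (hposdef : (DecentralizedEL.secondMomentMatrix μ g θ₀).PosDef)
    -- the numbers of nodes, which may vary with `n`, and the connected networks
    (K : ℕ → ℕ) (hK : ∀ n, 1 ≤ K n)
    (G : (n : ℕ) → SimpleGraph (Fin (K n))) (hG : ∀ n, (G n).Connected)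
    -- the tuning parameters
    (η : ℕ → ℝ) (hη : ∀ n, 0 < η n) :
    -- first regime: `η_n / N² → ∞`
    (Tendsto (fun n : ℕ => η n / ((K n : ℝ) * n) ^ 2) atTop atTop →
      (∀ θ : EuclideanSpace ℝ (Fin p), Integrable (fun x => g x θ) μ →
        DecentralizedEL.WithProbTendingToOne P fun n ω =>
          DecentralizedEL.SameSolutions (G n) (η n)
              (DecentralizedEL.gValues X g (K n) n θ ω) ∧
            (DecentralizedEL.ZeroInsideHull (DecentralizedEL.gValues X g (K n) n θ ω) →
              DecentralizedEL.MinimizersCoincide (G n) (η n)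
                (DecentralizedEL.gValues X g (K n) n θ ω))) ∧
      DecentralizedEL.WithProbTendingToOne P fun n ω =>
        DecentralizedEL.MinimizersCoincide (G n) (η n)
          (DecentralizedEL.gValues X g (K n) n θ₀ ω)) ∧
    -- second regime: `η_n / (K √(n log K)) → ∞` and `‖θ_n - θ₀‖ = O(N^{-1/2})`, for an estimating
    -- function that is mean-square continuous and has a mean of order `‖θ - θ₀‖` at `θ₀`
    ((fun n : ℕ => (K n : ℝ) * √(n * Real.log (K n))) =o[atTop] η →
      Tendsto (fun θ => ∫⁻ x, ‖g x θ - g x θ₀‖ₑ ^ 2 ∂μ) (𝓝 θ₀) (𝓝 0) →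
      (fun θ => ∫ x, g x θ ∂μ) =O[𝓝 θ₀] (fun θ => θ - θ₀) →
      ∀ θ : ℕ → EuclideanSpace ℝ (Fin p),
        (fun n => θ n - θ₀) =O[atTop] (fun n : ℕ => 1 / √((K n : ℝ) * n)) →
        DecentralizedEL.WithProbTendingToOne P fun n ω =>
          DecentralizedEL.MinimizersCoincide (G n) (η n)
            (DecentralizedEL.gValues X g (K n) n (θ n) ω)) := by
  have hμ : IsProbabilityMeasure μ := (hlaw 0 0).isProbabilityMeasure_iff.1 inferInstance
  have hL₀ : MemLp (fun x => g x θ₀) 2 μ :=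
    DecentralizedEL.memLp_two_of_integrable_mul (hgmeas θ₀) hfinite
  refine ⟨fun hlim => ⟨fun θ hθ => ?_, ?_⟩, fun hlim hsq hmean θ hθ => ?_⟩
  · refine (DecentralizedEL.withProbTendingToOne_sameSolutions hlaw hK hG hη hlim hθ).mono
      fun n ω h => ⟨h, fun hzero => hzero.noHalfSpace.minimizersCoincide h⟩
  · refine ((DecentralizedEL.withProbTendingToOne_sameSolutions hlaw hK hG hη hlim
      (hL₀.integrable one_le_two)).and (DecentralizedEL.withProbTendingToOne_noHalfSpace hlaw hindep
        hK (hgmeas θ₀) hunbiased hfinite hposdef)).mono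
      fun n ω h => h.2.minimizersCoincide h.1
  · have hNtop : Tendsto (fun n : ℕ => (K n : ℝ) * n) atTop atTop := by
      refine tendsto_atTop_mono (fun n => ?_) tendsto_natCast_atTop_atTop
      exact le_mul_of_one_le_left (Nat.cast_nonneg n) (by exact_mod_cast hK n)
    have hθlim : Tendsto θ atTop (𝓝 θ₀) := by
      have h1 : Tendsto (fun n : ℕ => 1 / √((K n : ℝ) * n)) atTop (𝓝 0) :=
        (Real.tendsto_sqrt_atTop.comp hNtop).const_div_atTop 1
      exact tendsto_sub_nhds_zero_iff.1 (hθ.trans_tendsto h1)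
    obtain ⟨hL, hdiff⟩ := DecentralizedEL.tendsto_integral_norm_sq_of_lintegral
      (h := fun n x => g x (θ n)) (fun n => hgmeas (θ n)) (hgmeas θ₀) hL₀ (hsq.comp hθlim)
    -- Both orders compose to `‖E g(X; θ_n)‖ ≤ C / √N`; squaring gives the bound `C ^ 2` on `N ‖E
    -- g(X; θ_n)‖²`.
    obtain ⟨C, hC⟩ := ((hmean.comp_tendsto hθlim).trans hθ).bound
    refine DecentralizedEL.withProbTendingToOne_minimizersCoincide hlaw hindep hK hG hη hlim
      (h := fun n x => g x (θ n)) (fun n => hgmeas (θ n)) (hgmeas θ₀) hfinite hposdef hL hdiff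
      (C := C ^ 2) ?_
    filter_upwards [hC, hNtop.eventually_gt_atTop 0] with n hn hN
    have h1 := pow_le_pow_left₀ (norm_nonneg _) hn 2
    rw [mul_pow, norm_div, norm_one, Real.norm_of_nonneg (Real.sqrt_nonneg _), div_pow,
      Real.sq_sqrt hN.le, one_pow, mul_one_div, le_div_iff₀ hN] at h1
    rw [mul_comm]
    exact h1
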